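/- Let $A_1,\dots,A_5$ be complex $5\times5$ matrices, and let $\tilde X_0\subset\mathbb P^4\times\mathbb P^4$ be defined by ${}^tzA_1w=\cdots={}^tzA_5w=0$. Embed $\mathbb P^4\times\mathbb P^4$ in $\mathbb P^{24}$ by the Segre embedding $x_{ij}=z_iw_j$; then $\tilde X_0$ is the section of $\mathbb P^4\times\mathbb P^4$ by the hyperplanes $H_k:\ \sum_{i,j}(A_k)_{ij}x_{ij}=0$, $k=1,\dots,5$. Let $h_k=[(A_k)_{ij}]\in(\mathbb P^{24})^*$ be the point dual to $H_k$, and let $(\mathbb P^4\times\mathbb P^4)^*\subset(\mathbb P^{24})^*$ be the dual variety of the Segre variety, that is, the Zariski closure of the set of hyperplanes tangent to it at a smooth point. The Mukai dual of $\tilde X_0$ is $$\tilde X_0^\sharp:=(\mathbb P^4\times\mathbb P^4)^*\cap\langle h_1,\dots,h_5\rangle ,$$ where $\langle h_1,\dots,h_5\rangle$ is the linear span of the points $h_k$. For a general choice of $(A_1,\dots,A_5)$, i.e. for all $(A_1,\dots,A_5)$ outside the zero set of some nonzero polynomial in the $125$ matrix entries, the following hold. The matrices $A_1,\dots,A_5$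 are linearly independent, so that $y\mapsto[\sum_k y_kA_k]$ identifies $\mathbb P^4$ with $\langle h_1,\dots,h_5\rangle$. Under this identification, $\tilde X_0^\sharp$ is the determinantal quintic hypersurface $$\Big\{[y]\in\mathbb P^4 : \det\Big(\sum_{k=1}^5y_kA_k\Big)=0\Big\};$$ here $\det(\sum_k y_kA_k)$ is a nonzero homogeneous polynomial of degree $5$ that generates the homogeneous ideal of $\tilde X_0^\sharp$ in $\mathbb C[y_1,\dots,y_5]$. The singular locus of $\tilde X_0^\sharp$ consists of exactly $50$ points, and each of them is an ordinary double point, i.e. near it the pair $(\mathbb P^4,\tilde X_0^\sharp)$ is biholomorphic to $(\mathbb C^4,\{x_1^2+x_2^2+x_3^2+x_4^2=0\})$ near $0$. -/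

import Mathlib

open MvPolynomial Topology
open scoped LinearAlgebra.Projectivization

noncomputable section

namespace DualQuintic

variable {ι : Type} [Fintype ι]

/-- The punctured affine cone over a subset of the projective space with homogeneous
coordinates indexed by `ι`. -/
def cone (X : Set (ℙ ℂ (ι → ℂ))) : Set (ι → ℂ) :=
  {v | ∃ hv : v ≠ 0, Projectivization.mk ℂ v hv ∈ X}

/-- The homogeneous ideal `I(X)` of a subset `X` of projective space: all polynomials
vanishing on the cone over `X`. -/
def projIdeal (X : Set (ℙ ℂ (ι → ℂ))) : Ideal (MvPolynomial ι ℂ) :=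
  MvPolynomial.vanishingIdeal ℂ (cone X)

/-- The Zariski closure of a subset of projective space. -/
def zariskiClosure (X : Set (ℙ ℂ (ι → ℂ))) : Set (ℙ ℂ (ι → ℂ)) :=
  {p | ∀ f ∈ projIdeal X, eval p.rep f = 0}

/-- The differential of the polynomial `f` at the point `x` of affine space. -/
def differential (f : MvPolynomial ι ℂ) (x : ι → ℂ) : (ι → ℂ) →ₗ[ℂ] ℂ :=
  ∑ i, eval x (pderiv i f) • LinearMap.proj i

/-- The linear space `T` such that `ℙ(T)` is the embedded projective tangent space of `X`
at `p`. -/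
def tangentSpace (X : Set (ℙ ℂ (ι → ℂ))) (p : ℙ ℂ (ι → ℂ)) : Submodule ℂ (ι → ℂ) :=
  ⨅ f ∈ projIdeal X, LinearMap.ker (differential f p.rep)

/-- The nonsingular points of a pure-dimensional projective variety: those where the dimension
of the tangent space is the smallest. -/
def smoothLocus (X : Set (ℙ ℂ (ι → ℂ))) : Set (ℙ ℂ (ι → ℂ)) :=
  {p | p ∈ X ∧ ∀ q ∈ X,
    Module.finrank ℂ (tangentSpace X p) ≤ Module.finrank ℂ (tangentSpace X q)}

/-- The singular points of a pure-dimensional projective variety. -/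
def singularLocus (X : Set (ℙ ℂ (ι → ℂ))) : Set (ℙ ℂ (ι → ℂ)) :=
  X \ smoothLocus X

/-- The dual variety of `X`: the Zariski closure of the set of hyperplanes tangent to `X` at
a smooth point. The point `[c]` of the dual projective space, in the dual homogeneous
coordinates, is the hyperplane `∑ i, c i * x i = 0`. -/
def dualVariety (X : Set (ℙ ℂ (ι → ℂ))) : Set (ℙ ℂ (ι → ℂ)) :=
  zariskiClosure {c | ∃ p ∈ smoothLocus X, ∀ v ∈ tangentSpace X p, c.rep ⬝ᵥ v = 0}

/-- The Mukai dual of the linear section of `X` by the hyperplanes `∑ i, h k i * x i = 0`: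
the intersection of the dual variety of `X` with the linear span of the points `[h k]` of the
dual projective space. -/
def mukaiDual {κ : Type} (X : Set (ℙ ℂ (ι → ℂ))) (h : κ → ι → ℂ) : Set (ℙ ℂ (ι → ℂ)) :=
  dualVariety X ∩ {c | c.rep ∈ Submodule.span ℂ (Set.range h)}

/-- `p` is an ordinary double point of the hypersurface `X` of `ℙ^n`: a biholomorphic map from
a neighbourhood of `0` in `ℂ^n` to a neighbourhood of `p` in `ℙ^n` carries `0` to `p` and the
quadric cone `∑ i, x i ^ 2 = 0` to `X`. The map is `x ↦ [φ x]`; by the inverse function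
theorem it is locally biholomorphic exactly if the derivative of `φ` at `0` is
injective modulo the line `p`. -/
def IsOrdinaryDoublePoint {n : ℕ} (X : Set (ℙ ℂ (Fin (n + 1) → ℂ)))
    (p : ℙ ℂ (Fin (n + 1) → ℂ)) : Prop :=
  ∃ φ : (Fin n → ℂ) → (Fin (n + 1) → ℂ),
    AnalyticAt ℂ φ 0 ∧ φ 0 = p.rep ∧
    (∀ x, fderiv ℂ φ 0 x ∈ p.submodule → x = 0) ∧
    ∀ᶠ x in 𝓝 (0 : Fin n → ℂ), φ x ∈ cone X ↔ ∑ i, x i ^ 2 = 0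

theorem segre_ne_zero {z w : Fin 5 → ℂ} (hz : z ≠ 0) (hw : w ≠ 0) :
    (fun ij : Fin 5 × Fin 5 => z ij.1 * w ij.2) ≠ 0 := by
  obtain ⟨i, hi⟩ := Function.ne_iff.1 hz
  obtain ⟨j, hj⟩ := Function.ne_iff.1 hw
  exact Function.ne_iff.2 ⟨(i, j), mul_ne_zero hi hj⟩

/-- The Segre embedding `ℙ^4 × ℙ^4 → ℙ^24`, `x_ij = z_i w_j`. -/
def segre (p : ℙ ℂ (Fin 5 → ℂ) × ℙ ℂ (Fin 5 → ℂ)) : ℙ ℂ (Fin 5 × Fin 5 → ℂ) :=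
  Projectivization.mk ℂ (fun ij => p.1.rep ij.1 * p.2.rep ij.2)
    (segre_ne_zero p.1.rep_nonzero p.2.rep_nonzero)

/-- The coefficients of the linear forms on `ℙ^24` that restrict to the bilinear forms
`ᵗz A_k w` on `ℙ^4 × ℙ^4`; they are the coordinates of the dual points `h_k`. -/
def dualPoint (A : Fin 5 → Matrix (Fin 5) (Fin 5) ℂ) (k : Fin 5) : Fin 5 × Fin 5 → ℂ :=
  fun ij => A k ij.1 ij.2

/-- The map `y ↦ ∑ k, y_k h_k`, which gives the homogeneous coordinates `y` on the span of the
points `h_k`. -/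
def spanMap (A : Fin 5 → Matrix (Fin 5) (Fin 5) ℂ) : (Fin 5 → ℂ) →ₗ[ℂ] (Fin 5 × Fin 5 → ℂ) :=
  Fintype.linearCombination ℂ (dualPoint A)

/-- The polynomial `det (∑ k, y_k A_k)` in the variables `y`. -/
def detPoly (A : Fin 5 → Matrix (Fin 5) (Fin 5) ℂ) : MvPolynomial (Fin 5) ℂ :=
  Matrix.det (∑ k, (MvPolynomial.X k : MvPolynomial (Fin 5) ℂ) • (A k).map MvPolynomial.C)

end DualQuintic

end

open MvPolynomial Topology
open scoped LinearAlgebra.Projectivization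

noncomputable section

namespace DualQuintic

/-! ### Parametrized polynomial systems and derivations on the generic fibre -/

section GenericEmptiness

/-! Put M = ∑ y_k A_k. A matrix N with MN = NM = 0 is a conormal vector at M to the stratum of
matrices of the rank of M, and the conditions tr(N A_k) = 0 say that it kills the whole linear
system. Hence "`Annihilates A y N` only for N = 0" means that the system is transversal to the rank
strata at M. This single condition drives the proof.

It holds for general A (`exists_forall_not_annihilates`). Otherwise the equations for (y, N) would
have a solution over a finite extension of the field of rational functions in the entries of A.
Partial derivatives extend to that field, and differentiating MN = 0 and taking traces gives y_c
N_ji = 0 for all indices, which is absurd (`Annihilates.mul_eq_zero_of_derivation`).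

A hyperplane is tangent to the Segre variety exactly if its matrix has nonzero left and right kernel
vectors, so the dual variety is det = 0 (`dualVariety_segre`), and the Mukai dual is the quintic det
M = 0. By Jacobi's formula the partial derivatives of det M are tr(adj(M) A_k). At a singular point
adj M is therefore an annihilator, hence zero: the singular points are those of corank at least two.
A dimension count bounds the corank by two, and transversality makes the four entries of a 2 × 2
Schur complement local coordinates on ℙ^4. The quintic is locally the determinant of this block, a
nondegenerate quadric in four variables (`exists_local_chart`,
`isOrdinaryDoublePoint_of_transversal`). A repeated factor of the quintic would be singular at
points outside this finite set, so the equation is squarefree and generates the ideal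
(`squarefree_detPoly`, `projIdeal_quintic`).

The number of singular points is constant along a complex line of systems with finitely many
nontransversal members removed, because the points persist, stay isolated and do not escape to
infinity (`ncard_degeneracyLocus_eq`). It is computed for `baseSystem`, where M has ten nonzero
positions arranged in a cycle, filled with linear forms any five of which are independent. There adj
M has monomial entries up to sign, and its zeros correspond to the sets of four positions that meet
all 25 monomials; there are 50 of them (`ncard_degeneracyLocus_baseSystem`). -/

/-- A derivation extends along a formally étale algebra. -/
theorem exists_derivation_extending {R S T : Type} [CommRing R] [CommRing S] [CommRing T]
    [Algebra R S] [Algebra R T] [Algebra S T] [IsScalarTower R S T] [Algebra.FormallyEtale S T]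
    (d : Derivation R S S) :
    ∃ D : Derivation R T T, ∀ s, D (algebraMap S T s) = algebraMap S T (d s) := by
  let d' : Derivation R S T := (Algebra.linearMap S T).compDer d
  let l : TensorProduct S T (Ω[S⁄R]) →ₗ[T] T :=
    TensorProduct.AlgebraTensorModule.lift
      ((LinearMap.toSpanSingleton T (Ω[S⁄R] →ₗ[S] T) d'.liftKaehlerDifferential))
  -- Along a formally étale map the Kähler differentials are obtained by base change, so the linear
  -- form on them given by `d` extends to `T`.
  let e := KaehlerDifferential.tensorKaehlerEquivOfFormallyEtale R S T
  refine ⟨(l ∘ₗ e.symm.toLinearMap).compDer (KaehlerDifferential.D R T), fun s => ?_⟩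
  have := KaehlerDifferential.tensorKaehlerEquivOfFormallyEtale_symm_D_algebraMap R S T s
  simp [e, this, l, d']

/-- If `L` is a field of finite type over the field of rational functions in the variables `σ`,
then the partial derivatives extend to `L`. -/
theorem exists_derivation_extending_pderiv {k σ K L : Type} [Field k] [CharZero k]
    [Field K] [Algebra (MvPolynomial σ k) K] [IsFractionRing (MvPolynomial σ k) K]
    [Field L] [Algebra K L] [Algebra.FiniteType K L]
    [Algebra (MvPolynomial σ k) L] [IsScalarTower (MvPolynomial σ k) K L]
    [Algebra k L] [IsScalarTower k (MvPolynomial σ k) L] (s : σ) :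
    ∃ D : Derivation k L L, ∀ p, D (algebraMap _ L p) =
      algebraMap (MvPolynomial σ k) L (pderiv s p) := by
  have : CharZero K := charZero_of_injective_algebraMap
    (IsFractionRing.injective (MvPolynomial σ k) K)
  -- Zariski's lemma. In characteristic zero the finite extension is separable, hence formally
  -- étale, and so is the localization from the polynomial ring to `K`.
  have : Module.Finite K L := finite_of_finite_type_of_isJacobsonRing K L
  have : Algebra.FormallyEtale K L := Algebra.FormallyEtale.of_isSeparable K L
  have : Algebra.FormallyEtale (MvPolynomial σ k) K :=
    Algebra.FormallyEtale.of_isLocalization (nonZeroDivisors (MvPolynomial σ k))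
  have : Algebra.FormallyEtale (MvPolynomial σ k) L :=
    Algebra.FormallyEtale.comp (MvPolynomial σ k) K L
  exact exists_derivation_extending (pderiv s)

attribute [local instance] MvPolynomial.algebraMvPolynomial

/-- A polynomial system with parameters that has no point over a field carrying extensions of
all derivations with respect to the parameters has no solution for general parameters. -/
theorem exists_C_mem_of_forall_derivation {k σ τ : Type} [Field k] [CharZero k] [Finite τ]
    (J : Ideal (MvPolynomial τ (MvPolynomial σ k)))
    (h : ∀ (L : Type) [Field L] [Algebra k L] [Algebra (MvPolynomial σ k) L]
      [IsScalarTower k (MvPolynomial σ k) L] (D : σ → Derivation k L L) (x : τ → L),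
      (∀ s p, D s (algebraMap _ L p) = algebraMap (MvPolynomial σ k) L (pderiv s p)) →
      (∀ g ∈ J, aeval x g = 0) → False) :
    ∃ F : MvPolynomial σ k, F ≠ 0 ∧ C F ∈ J := by
  by_contra! hJ
  have hdisj : Disjoint (((nonZeroDivisors (MvPolynomial σ k)).map
        (C : _ →+* MvPolynomial τ (MvPolynomial σ k)) : Submonoid _) : Set _)
      (J : Set (MvPolynomial τ (MvPolynomial σ k))) := by
    rw [Set.disjoint_left]
    rintro _ ⟨F, hF, rfl⟩ hFJ
    exact hJ F (nonZeroDivisors.ne_zero hF) hFJ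
  -- If `J` contains no nonzero parameter polynomial, it stays proper over the field of rational
  -- functions. The residue field at a maximal ideal above it then provides the point excluded by
  -- `h`.
  have hne := (IsLocalization.map_algebraMap_ne_top_iff_disjoint
    (S := MvPolynomial τ (FractionRing (MvPolynomial σ k))) _ J).2 hdisj
  obtain ⟨m, hm, hle⟩ := Ideal.exists_le_maximal _ hne
  obtain ⟨L, iF, iA, q, hq, hqm⟩ : ∃ (L : Type) (_ : Field L)
      (_ : Algebra (FractionRing (MvPolynomial σ k)) L)
      (q : MvPolynomial τ (FractionRing (MvPolynomial σ k))
        →ₐ[FractionRing (MvPolynomial σ k)] L),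
      Function.Surjective q ∧ ∀ g ∈ m, q g = 0 :=
    ⟨_ ⧸ m, Ideal.Quotient.field m, inferInstance, Ideal.Quotient.mkₐ _ m,
      Ideal.Quotient.mkₐ_surjective _ m, fun g hg => Ideal.Quotient.eq_zero_iff_mem.2 hg⟩
  have : Algebra.FiniteType (FractionRing (MvPolynomial σ k)) L :=
    Algebra.FiniteType.of_surjective q hq
  let _ : Algebra (MvPolynomial σ k) L := ((algebraMap (FractionRing (MvPolynomial σ k)) L).comp
    (algebraMap (MvPolynomial σ k) _)).toAlgebra
  have : IsScalarTower (MvPolynomial σ k) (FractionRing (MvPolynomial σ k)) L :=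
    IsScalarTower.of_algebraMap_eq fun _ => rfl
  let _ : Algebra k L := ((algebraMap (MvPolynomial σ k) L).comp (algebraMap k _)).toAlgebra
  have : IsScalarTower k (MvPolynomial σ k) L := IsScalarTower.of_algebraMap_eq fun _ => rfl
  choose D hD using exists_derivation_extending_pderiv (k := k) (σ := σ)
    (K := FractionRing (MvPolynomial σ k)) (L := L)
  refine h L D (fun t => q (X t)) hD fun g hg => ?_
  have hx : (aeval (fun t => q (X t)) : MvPolynomial τ (MvPolynomial σ k) →ₐ[_] L).toRingHom =
      q.toRingHom.comp (map (algebraMap (MvPolynomial σ k) (FractionRing (MvPolynomial σ k)))) := by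
    refine MvPolynomial.ringHom_ext (fun r => ?_) (fun i => ?_)
    · simp [IsScalarTower.algebraMap_apply (MvPolynomial σ k)
        (FractionRing (MvPolynomial σ k)) L]
    · simp
  have hg' := congrArg (fun f : MvPolynomial τ (MvPolynomial σ k) →+* L => f g) hx
  exact hg'.trans (hqm _ (hle (Ideal.mem_map_of_mem _ hg)))

end GenericEmptiness

/-! ### Conormal vectors to the rank strata, and transversality of a general system -/

section GenericTransversality

/-- The linear combination `∑ k, y k • A k` of the matrices `A k`. -/
def pencil {κ n R : Type} [Fintype κ] [CommRing R] (A : κ → Matrix n n R) (y : κ → R) :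
    Matrix n n R :=
  ∑ k, y k • A k

theorem pencil_apply {κ n R : Type} [Fintype κ] [CommRing R] (A : κ → Matrix n n R) (y : κ → R)
    (i j : n) : pencil A y i j = ∑ k, y k * A k i j := by
  simp [pencil, Matrix.sum_apply]

theorem pencil_map {κ n R S : Type} [Fintype κ] [CommRing R] [CommRing S]
    (A : κ → Matrix n n R) (y : κ → R) (φ : R →+* S) :
    (pencil A y).map φ = pencil (fun k => (A k).map φ) (fun k => φ (y k)) := by
  ext i j
  simp [pencil_apply]

/-- `N` represents a linear form on the space of matrices that vanishes on the tangent space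
of the stratum of matrices of constant rank at `pencil A y` and on all the matrices `A k`. -/
def Annihilates {κ n R : Type} [Fintype κ] [Fintype n] [CommRing R] (A : κ → Matrix n n R)
    (y : κ → R) (N : Matrix n n R) : Prop :=
  pencil A y * N = 0 ∧ N * pencil A y = 0 ∧ ∀ k, (N * A k).trace = 0

/-- Every matrix over a field has a generalized inverse. -/
theorem exists_mul_mul_eq_self {n K : Type} [Fintype n] [DecidableEq n] [Field K]
    (M : Matrix n n K) : ∃ G : Matrix n n K, M * G * M = M := by
  obtain ⟨g, hg⟩ := M.toLin'.rangeRestrict.exists_rightInverse_of_surjective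
    (LinearMap.range_rangeRestrict _)
  obtain ⟨g', hg'⟩ := LinearMap.exists_extend g
  refine ⟨LinearMap.toMatrix' g', ?_⟩
  apply Matrix.toLin'.injective
  rw [Matrix.toLin'_mul, Matrix.toLin'_mul, Matrix.toLin'_toMatrix']
  ext1 j
  ext1
  have h1 := LinearMap.congr_fun hg' (M.toLin'.rangeRestrict (Pi.single j 1))
  have h2 := LinearMap.congr_fun hg (M.toLin'.rangeRestrict (Pi.single j 1))
  have h3 := congrArg Subtype.val h2
  simp only [LinearMap.comp_apply, Submodule.subtype_apply, LinearMap.codRestrict_apply,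
    LinearMap.rangeRestrict, LinearMap.id_apply, LinearMap.single_apply] at h1 h3 ⊢
  rw [h1]
  exact h3

/-- Over a field with derivations with respect to all the entries of `A`, nothing nonzero
annihilates. -/
theorem Annihilates.mul_eq_zero_of_derivation {κ n k L : Type} [Fintype κ] [Fintype n]
    [DecidableEq κ] [DecidableEq n] [CommRing k] [Field L] [Algebra k L] {A : κ → Matrix n n L}
    {y : κ → L} {N : Matrix n n L} (h : Annihilates A y N) (D : κ × n × n → Derivation k L L)
    (hD : ∀ s t, D s (A t.1 t.2.1 t.2.2) = if t = s then 1 else 0) (c : κ) (i j : n) :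
    y c * N j i = 0 := by
  obtain ⟨h1, h2, h3⟩ := h
  set d := D (c, i, j) with hd
  set M := pencil A y with hM
  -- The derivation with respect to the entry (i, j) of `A c` also acts on `y`, but only through a
  -- member of the linear system, which `N` annihilates.
  have hdM : M.map d = pencil A (fun a => d (y a)) + y c • Matrix.single i j 1 := by
    ext a b
    have h5 : ∀ e, d (A e a b) = if (e, a, b) = (c, i, j) then 1 else 0 :=
      fun e => hD (c, i, j) (e, a, b)
    simp only [hM, Matrix.map_apply, pencil_apply, map_sum, Derivation.leibniz, h5,
      Matrix.add_apply, Matrix.smul_apply, Finset.sum_add_distrib, smul_eq_mul, Prod.mk.injEq,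
      Matrix.single_apply]
    rw [add_comm]
    congr 1
    · exact Finset.sum_congr rfl fun _ _ => mul_comm _ _
    · rw [Finset.sum_eq_single c (by intro e _ he; simp [he]) (by simp)]
      simp [eq_comm]
  have hleib : M.map d * N = -(M * N.map d) := by
    rw [eq_neg_iff_add_eq_zero]
    ext a b
    have h5 : d ((M * N) a b) = 0 := by rw [h1]; simp
    simp only [Matrix.mul_apply, map_sum, Derivation.leibniz, Finset.sum_add_distrib,
      smul_eq_mul] at h5
    simp only [Matrix.add_apply, Matrix.mul_apply, Matrix.map_apply, Matrix.zero_apply]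
    rw [← h5, add_comm]
    congr 1
    exact Finset.sum_congr rfl fun _ _ => mul_comm _ _
  have htr : (M.map d * N).trace = y c * N j i := by
    rw [hdM, add_mul, Matrix.trace_add]
    have : (pencil A (fun a => d (y a)) * N).trace = 0 := by
      rw [pencil, Finset.sum_mul, Matrix.trace_sum]
      refine Finset.sum_eq_zero fun e _ => ?_
      rw [Matrix.smul_mul, Matrix.trace_smul, Matrix.trace_mul_comm, h3, smul_zero]
    rw [this, zero_add, Matrix.smul_mul, Matrix.trace_smul, Matrix.trace_single_mul, one_smul,
      smul_eq_mul]
  -- With MGM = M one gets M dN = MGM dN = -MG dM N, whose trace vanishes because NM = 0.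
  obtain ⟨G, hG⟩ := exists_mul_mul_eq_self M
  have hMN : (M * N.map d).trace = 0 := by
    have h6 : M * N.map d = -(M * G * M.map d * N) := by
      rw [Matrix.mul_assoc, hleib, Matrix.mul_neg, neg_neg, ← Matrix.mul_assoc, hG]
    rw [h6, Matrix.trace_neg, Matrix.trace_mul_comm, Matrix.mul_assoc, ← Matrix.mul_assoc, h2,
      Matrix.zero_mul, Matrix.trace_zero, neg_zero]
  rw [← htr, hleib, Matrix.trace_neg, hMN, neg_zero]

/-! ### The incidence ideal of points and annihilators -/

section Universal

variable (κ n : Type) [Fintype κ] [Fintype n]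

/-- The unknowns: the coordinates of a point, the entries of a matrix, and the coefficients of
a linear form for each of them. -/
abbrev Unknown : Type := (κ ⊕ n × n) ⊕ (κ ⊕ n × n)

/-- Polynomials in the unknowns with the entries of the matrices as parameters. -/
abbrev SystemRing : Type := MvPolynomial (Unknown κ n) (MvPolynomial (κ × n × n) ℂ)

/-- The matrices with indeterminate entries. -/
def universalMatrix (k : κ) : Matrix n n (SystemRing κ n) :=
  Matrix.of fun i j => C (X (k, i, j))

/-- The indeterminate point. -/
def universalPoint (k : κ) : SystemRing κ n := X (Sum.inl (Sum.inl k))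

/-- The indeterminate annihilator. -/
def universalAnnihilator : Matrix n n (SystemRing κ n) :=
  Matrix.of fun i j => X (Sum.inl (Sum.inr (i, j)))

/-- The ideal of the triples of a tuple of matrices, a nonzero point and a nonzero annihilator. -/
def annihilatorIdeal : Ideal (SystemRing κ n) :=
  Ideal.span (
    Set.range (fun ij : n × n =>
      (pencil (universalMatrix κ n) (universalPoint κ n) * universalAnnihilator κ n) ij.1 ij.2) ∪
    Set.range (fun ij : n × n =>
      (universalAnnihilator κ n * pencil (universalMatrix κ n) (universalPoint κ n)) ij.1 ij.2) ∪
    Set.range (fun k => (universalAnnihilator κ n * universalMatrix κ n k).trace) ∪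
    {∑ k, X (Sum.inr (Sum.inl k)) * X (Sum.inl (Sum.inl k)) - 1,
      ∑ ij, X (Sum.inr (Sum.inr ij)) * X (Sum.inl (Sum.inr ij)) - 1})

variable {κ n}

/-- The last two generators turn y ≠ 0 and N ≠ 0 into equations, since over a field a vector is
nonzero exactly if some linear form takes the value 1 on it. The criterion serves both the generic
point and the specialization to complex matrices. -/
theorem annihilatorIdeal_le_ker_iff {L : Type} [CommRing L] (φ : SystemRing κ n →+* L) :
    annihilatorIdeal κ n ≤ RingHom.ker φ ↔
      Annihilates (fun k => (universalMatrix κ n k).map φ) (fun k => φ (universalPoint κ n k))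
        ((universalAnnihilator κ n).map φ) ∧
      ∑ k, φ (X (Sum.inr (Sum.inl k))) * φ (X (Sum.inl (Sum.inl k))) = 1 ∧
      ∑ ij, φ (X (Sum.inr (Sum.inr ij))) * φ (X (Sum.inl (Sum.inr ij))) = 1 := by
  have hmul : ∀ B B' : Matrix n n (SystemRing κ n),
      B.map φ * B'.map φ = 0 ↔ ∀ ij : n × n, φ ((B * B') ij.1 ij.2) = 0 := by
    intro B B'
    rw [← Matrix.map_mul, ← Matrix.ext_iff]
    simp [Prod.forall]
  have htr : ∀ B B' : Matrix n n (SystemRing κ n),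
      (B.map φ * B'.map φ).trace = φ ((B * B').trace) := by
    intro B B'
    rw [← Matrix.map_mul]
    simp only [Matrix.trace, Matrix.diag, Matrix.map_apply, map_sum]
  rw [annihilatorIdeal, Ideal.span_le, Annihilates, ← pencil_map, hmul, hmul]
  simp only [htr, Set.union_subset_iff, Set.range_subset_iff, Set.insert_subset_iff,
    Set.singleton_subset_iff, SetLike.mem_coe, RingHom.mem_ker, map_sub, map_sum, map_mul, map_one,
    sub_eq_zero]
  tauto

end Universal

theorem exists_sum_mul_eq_one {ι : Type} [Fintype ι] {v : ι → ℂ} (hv : v ≠ 0) :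
    ∃ a : ι → ℂ, ∑ i, a i * v i = 1 := by
  classical
  obtain ⟨i, hi⟩ := Function.ne_iff.1 hv
  refine ⟨Pi.single i (v i)⁻¹, ?_⟩
  rw [Finset.sum_eq_single i (by intro b _ hb; simp [hb]) (by simp)]
  simpa using inv_mul_cancel₀ hi

/-- A general linear system of matrices is transversal to all strata of matrices of constant
rank. -/
theorem exists_forall_not_annihilates (κ n : Type) [Fintype κ] [Fintype n] :
    ∃ F : MvPolynomial (κ × n × n) ℂ, F ≠ 0 ∧ ∀ A : κ → Matrix n n ℂ,
      eval (fun t => A t.1 t.2.1 t.2.2) F ≠ 0 → ∀ y N, y ≠ 0 → Annihilates A y N → N = 0 := by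
  classical
  obtain ⟨F, hF, hmem⟩ := exists_C_mem_of_forall_derivation (annihilatorIdeal κ n) (by
    intro L _ _ _ _ D x hD hx
    obtain ⟨hann, hy, hN⟩ := (annihilatorIdeal_le_ker_iff
      (aeval x : SystemRing κ n →ₐ[_] L).toRingHom).1 hx
    have h0 := hann.mul_eq_zero_of_derivation D (by
      intro s t
      simp only [universalMatrix, Matrix.map_apply, Matrix.of_apply, AlgHom.toRingHom_eq_coe,
        RingHom.coe_coe, ← MvPolynomial.algebraMap_eq, AlgHom.commutes, hD, pderiv_X]
      by_cases hst : t = s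
      · simp [hst]
      · simp [hst])
    -- Expanding 1 = (∑ b_c y_c)(∑ b'_ij N_ij) gives only terms with a factor y_c N_ij, and these
    -- all vanish.
    apply one_ne_zero (α := L)
    rw [← one_mul (1 : L)]
    nth_rw 1 [← hy]
    rw [← hN, Finset.sum_mul_sum]
    refine Finset.sum_eq_zero fun c _ => Finset.sum_eq_zero fun ij _ => ?_
    have := h0 c ij.2 ij.1
    simp only [universalPoint, universalAnnihilator, Matrix.map_apply, Matrix.of_apply,
      Prod.mk.eta] at this
    linear_combination ((aeval x : SystemRing κ n →ₐ[_] L).toRingHom (X (Sum.inr (Sum.inl c))) *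
      (aeval x : SystemRing κ n →ₐ[_] L).toRingHom (X (Sum.inr (Sum.inr ij)))) * this)
  refine ⟨F, hF, fun A hA y N hy hAnn => ?_⟩
  by_contra hN
  obtain ⟨a, ha⟩ := exists_sum_mul_eq_one hy
  obtain ⟨b, hb⟩ := exists_sum_mul_eq_one (v := fun ij : n × n => N ij.1 ij.2)
    (fun h => hN (by ext i j; exact congrFun h (i, j)))
  -- A bad triple of complex values is a homomorphism that kills the ideal, hence kills `F`.
  let φ : SystemRing κ n →+* ℂ := eval₂Hom (eval (fun t => A t.1 t.2.1 t.2.2))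
    (Sum.elim (Sum.elim y (fun ij => N ij.1 ij.2)) (Sum.elim a b))
  have hle : annihilatorIdeal κ n ≤ RingHom.ker φ := by
    rw [annihilatorIdeal_le_ker_iff]
    refine ⟨?_, by simpa [φ] using ha, by simpa [φ] using hb⟩
    convert hAnn
    · ext; simp [φ, universalMatrix]
    · simp [φ, universalPoint]
    · ext; simp [φ, universalAnnihilator]
  have := hle hmem
  simp [φ, RingHom.mem_ker] at this
  exact hA this

end GenericTransversality

/-! ### Corank two: dimension count, Schur complement and normal form -/

section LocalChart

open Matrix

/-- If the kernel and the cokernel of a nonzero point of a linear system are large compared with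
the dimension of the system, then a nonzero matrix annihilates. -/
theorem exists_annihilates_of_card_le {κ n p q : Type} [Fintype κ] [Fintype n] [Fintype p]
    [Fintype q] [DecidableEq p] [DecidableEq q] {A : κ → Matrix n n ℂ} {y : κ → ℂ} (hy : y ≠ 0)
    {R : Matrix n p ℂ} {R' : Matrix p n ℂ} {E : Matrix q n ℂ} {E' : Matrix n q ℂ}
    (hR : pencil A y * R = 0) (hE : E * pencil A y = 0) (hR' : R' * R = 1) (hE' : E * E' = 1)
    (hcard : Fintype.card κ ≤ Fintype.card p * Fintype.card q) :
    ∃ N, N ≠ 0 ∧ Annihilates A y N := by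
  let Ψ : Matrix p q ℂ →ₗ[ℂ] (κ → ℂ) :=
    { toFun := fun c k => (R * c * E * A k).trace
      map_add' := fun c c' => by
        ext k; simp [Matrix.mul_add, Matrix.add_mul]
      map_smul' := fun a c => by
        ext k; simp }
  -- The image of `Ψ` lies in the proper hyperplane orthogonal to `y`, so `hcard` leaves no room for
  -- injectivity. A nonzero kernel element c yields the annihilator R c E.
  have hΨ : ∀ c, ∑ k, y k * Ψ c k = 0 := by
    intro c
    have : (R * c * E * pencil A y).trace = 0 := by
      rw [Matrix.mul_assoc, hE, Matrix.mul_zero, Matrix.trace_zero]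
    rw [pencil, Finset.mul_sum, Matrix.trace_sum] at this
    simpa [Ψ] using this
  by_contra! hcon
  have hinj : Function.Injective Ψ := by
    rw [← LinearMap.ker_eq_bot, LinearMap.ker_eq_bot']
    intro c hc
    have h0 : R * c * E = 0 := by
      by_contra hne
      refine hcon _ hne ⟨?_, ?_, fun k => congrFun hc k⟩
      · rw [← Matrix.mul_assoc, ← Matrix.mul_assoc, hR, Matrix.zero_mul, Matrix.zero_mul]
      · rw [Matrix.mul_assoc, hE, Matrix.mul_zero]
    calc c = R' * R * c * (E * E') := by rw [hR', hE', Matrix.one_mul, Matrix.mul_one]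
      _ = R' * (R * c * E) * E' := by simp only [Matrix.mul_assoc]
      _ = 0 := by rw [h0, Matrix.mul_zero, Matrix.zero_mul]
  have hdim : Module.finrank ℂ (Matrix p q ℂ) = Module.finrank ℂ (κ → ℂ) := by
    refine le_antisymm (LinearMap.finrank_le_finrank_of_injective hinj) ?_
    rw [Module.finrank_matrix, Module.finrank_fintype_fun_eq_card]
    simpa using hcard
  have hsurj : Function.Surjective Ψ :=
    (LinearMap.injective_iff_surjective_of_finrank_eq_finrank hdim).1 hinj
  obtain ⟨a, ha⟩ := exists_sum_mul_eq_one hy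
  obtain ⟨c, hc⟩ := hsurj a
  have := hΨ c
  rw [hc] at this
  apply one_ne_zero (α := ℂ)
  rw [← ha, ← this]
  exact Finset.sum_congr rfl fun _ _ => mul_comm _ _

theorem adjugate_mul_mul_eq_zero_iff {n : Type} [Fintype n] [DecidableEq n] {P Q : Matrix n n ℂ}
    (hP : P.det ≠ 0) (hQ : Q.det ≠ 0) (M : Matrix n n ℂ) :
    (P * M * Q).adjugate = 0 ↔ M.adjugate = 0 := by
  rw [adjugate_mul_distrib, adjugate_mul_distrib]
  constructor
  · intro h
    have h1 : Q * (Q.adjugate * (M.adjugate * P.adjugate)) * P = 0 := by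
      rw [h, Matrix.mul_zero, Matrix.zero_mul]
    have h2 : Q * (Q.adjugate * (M.adjugate * P.adjugate)) * P =
        (Q.det * P.det) • M.adjugate := by
      calc _ = (Q * Q.adjugate) * M.adjugate * (P.adjugate * P) := by
            simp only [Matrix.mul_assoc]
        _ = _ := by
          rw [mul_adjugate, adjugate_mul]
          simp [smul_smul, mul_comm]
    rw [h2] at h1
    exact (smul_eq_zero.1 h1).resolve_left (mul_ne_zero hQ hP)
  · intro h
    rw [h, Matrix.zero_mul, Matrix.mul_zero]

/-- Cofactors at positions of the lower block are det a times those of `s`, and for a 2 × 2 matrix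
the cofactors are the entries up to sign and order. Conversely, if `s` = 0, replacing one row still
leaves a zero row. -/
theorem adjugate_fromBlocks_zero_zero_eq_zero_iff {m : Type} [Fintype m] [DecidableEq m]
    {a : Matrix m m ℂ} (ha : a.det ≠ 0) (s : Matrix (Fin 2) (Fin 2) ℂ) :
    (fromBlocks a 0 0 s).adjugate = 0 ↔ s = 0 := by
  constructor
  · intro h
    have hs : s.adjugate = 0 := by
      ext i j
      have h1 := congrFun (congrFun h (Sum.inr i)) (Sum.inr j)
      rw [adjugate_apply] at h1
      have h2 : (fromBlocks a 0 0 s).updateRow (Sum.inr j) (Pi.single (Sum.inr i) 1) =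
          fromBlocks a 0 0 (s.updateRow j (Pi.single i 1)) := by
        ext x z
        rcases x with x | x <;> rcases z with z | z <;>
          simp [Matrix.updateRow_apply, Pi.single_apply]
      rw [h2, det_fromBlocks_zero₁₂, Matrix.zero_apply] at h1
      rw [adjugate_apply, Matrix.zero_apply]
      exact (mul_eq_zero.1 h1).resolve_left ha
    rw [adjugate_fin_two] at hs
    ext i j
    have h00 := congrFun (congrFun hs 0) 0
    have h01 := congrFun (congrFun hs 0) 1
    have h10 := congrFun (congrFun hs 1) 0
    have h11 := congrFun (congrFun hs 1) 1
    simp at h00 h01 h10 h11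
    fin_cases i <;> fin_cases j <;> simp [*]
  · rintro rfl
    ext x z
    rw [adjugate_apply, Matrix.zero_apply]
    obtain ⟨j, hj⟩ : ∃ j : Fin 2, (Sum.inr j : m ⊕ Fin 2) ≠ z := by
      by_contra! hall
      simpa using (hall 0).trans (hall 1).symm
    apply det_eq_zero_of_row_eq_zero (Sum.inr j)
    intro k
    rw [updateRow_ne hj]
    rcases k with k | k <;> simp

/-- The Schur complement of the upper left block, multiplied by the determinant of this block. -/
def scaledSchur {m : Type} [Fintype m] [DecidableEq m]
    (X : Matrix (m ⊕ Fin 2) (m ⊕ Fin 2) ℂ) : Matrix (Fin 2) (Fin 2) ℂ :=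
  X.toBlocks₁₁.det • X.toBlocks₂₂ - X.toBlocks₂₁ * X.toBlocks₁₁.adjugate * X.toBlocks₁₂

/-- The block LDU factorization has unipotent outer factors, so X may be replaced by the block
diagonal matrix of a and the Schur complement. Scaling by det a does not change the zeros and makes
the complement polynomial in the entries of X. -/
theorem scaledSchur_iff {m : Type} [Fintype m] [DecidableEq m]
    {X : Matrix (m ⊕ Fin 2) (m ⊕ Fin 2) ℂ} (hX : X.toBlocks₁₁.det ≠ 0) :
    (X.adjugate = 0 ↔ scaledSchur X = 0) ∧ (X.det = 0 ↔ (scaledSchur X).det = 0) := by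
  set a := X.toBlocks₁₁
  have hu : IsUnit a.det := isUnit_iff_ne_zero.2 hX
  let _ : Invertible a := invertibleOfIsUnitDet a hu
  have hs : scaledSchur X = a.det • (X.toBlocks₂₂ - X.toBlocks₂₁ * ⅟a * X.toBlocks₁₂) := by
    have hadj : a.adjugate = a.det • ⅟a := by
      rw [invOf_eq_nonsing_inv, inv_def, smul_smul, Ring.mul_inverse_cancel _ hu, one_smul]
    rw [scaledSchur, hadj, smul_sub, Matrix.mul_smul, Matrix.smul_mul]
  have hX' : X = fromBlocks a X.toBlocks₁₂ X.toBlocks₂₁ X.toBlocks₂₂ :=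
    (fromBlocks_toBlocks X).symm
  rw [hs, smul_eq_zero, or_iff_right hX, det_smul, mul_eq_zero,
    or_iff_right (pow_ne_zero _ hX)]
  constructor
  · conv_lhs => rw [hX']
    rw [fromBlocks_eq_of_invertible₁₁, adjugate_mul_mul_eq_zero_iff (by simp) (by simp),
      adjugate_fromBlocks_zero_zero_eq_zero_iff hX]
  · conv_lhs => rw [hX']
    rw [det_fromBlocks₁₁, mul_eq_zero, or_iff_right hX]

/-- A matrix all of whose minors of corank one vanish is equivalent to a diagonal matrix with two
zeros at the end. -/
theorem exists_normalForm {M : Matrix (Fin 5) (Fin 5) ℂ} (hM : M.adjugate = 0) :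
    ∃ (P Q : Matrix (Fin 5) (Fin 5) ℂ) (e : Fin 3 ⊕ Fin 2 ≃ Fin 5) (d : Fin 3 → ℂ),
      P.det ≠ 0 ∧ Q.det ≠ 0 ∧ (P * M * Q).submatrix e e = fromBlocks (diagonal d) 0 0 0 := by
  obtain ⟨L, L', D, hD⟩ := Pivot.exists_list_transvec_mul_mul_list_transvec_eq_diagonal M
  set P := (L.map TransvectionStruct.toMatrix).prod with hP
  set Q := (L'.map TransvectionStruct.toMatrix).prod with hQ
  have hPd : P.det ≠ 0 := by simp [hP]
  have hQd : Q.det ≠ 0 := by simp [hQ]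
  have hadj : (diagonal D).adjugate = 0 := by
    rw [← hD, adjugate_mul_mul_eq_zero_iff hPd hQd, hM]
  rw [adjugate_diagonal] at hadj
  -- Each diagonal cofactor is the product of the other diagonal entries. Applying this twice gives
  -- two distinct zeros, which σ moves to the last two places.
  have hz : ∀ i, ∃ k, k ≠ i ∧ D k = 0 := by
    intro i
    have := congrFun (congrFun hadj i) i
    simp only [diagonal_apply_eq, Matrix.zero_apply, Finset.prod_eq_zero_iff] at this
    simpa using this
  obtain ⟨i, -, hi⟩ := hz 0
  obtain ⟨j, hj, hj0⟩ := hz i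
  obtain ⟨σ, hσi, hσj⟩ : ∃ σ : Equiv.Perm (Fin 5), σ 3 = i ∧ σ 4 = j := by
    refine ⟨(Equiv.swap 4 (Equiv.swap 3 i j)).trans (Equiv.swap 3 i), ?_, ?_⟩
    · have h3 : (3 : Fin 5) ≠ Equiv.swap 3 i j := by
        intro h
        have := congrArg (Equiv.swap 3 i) h
        rw [Equiv.swap_apply_left, Equiv.swap_apply_self] at this
        exact hj this.symm
      have h4 : Equiv.swap 4 (Equiv.swap 3 i j) 3 = 3 :=
        Equiv.swap_apply_of_ne_of_ne (by decide) h3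
      rw [Equiv.trans_apply, h4, Equiv.swap_apply_left]
    · rw [Equiv.trans_apply, Equiv.swap_apply_left, Equiv.swap_apply_self]
  let e : Fin 3 ⊕ Fin 2 ≃ Fin 5 := (finSumFinEquiv (m := 3) (n := 2)).trans σ
  refine ⟨P, Q, e, fun a => D (e (Sum.inl a)), hPd, hQd, ?_⟩
  rw [hD, submatrix_diagonal_equiv]
  have h2 : ∀ b : Fin 2, D (e (Sum.inr b)) = 0 := by
    intro b
    fin_cases b
    · exact (congrArg D hσi).trans hi
    · exact (congrArg D hσj).trans hj0
  ext x z
  rcases x with x | x <;> rcases z with z | z <;> simp [diagonal_apply, h2]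

/-- Change of bases and of indices. -/
def transform (P Q : Matrix (Fin 5) (Fin 5) ℂ) (e : Fin 3 ⊕ Fin 2 ≃ Fin 5) :
    Matrix (Fin 5) (Fin 5) ℂ →ₗ[ℂ] Matrix (Fin 3 ⊕ Fin 2) (Fin 3 ⊕ Fin 2) ℂ where
  toFun M := (P * M * Q).submatrix e e
  map_add' M M' := by rw [Matrix.mul_add, Matrix.add_mul]; rfl
  map_smul' c M := by rw [Matrix.mul_smul, Matrix.smul_mul]; rfl

theorem adjugate_transform_eq_zero_iff {P Q : Matrix (Fin 5) (Fin 5) ℂ} (hP : P.det ≠ 0)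
    (hQ : Q.det ≠ 0) (e : Fin 3 ⊕ Fin 2 ≃ Fin 5) (M : Matrix (Fin 5) (Fin 5) ℂ) :
    (transform P Q e M).adjugate = 0 ↔ M.adjugate = 0 := by
  rw [← adjugate_mul_mul_eq_zero_iff hP hQ M]
  change ((P * M * Q).submatrix e e).adjugate = 0 ↔ _
  rw [adjugate_submatrix_equiv_self]
  constructor
  · intro h
    ext i j
    simpa using congrFun (congrFun h (e.symm i)) (e.symm j)
  · intro h
    rw [h]
    rfl

theorem det_transform_eq_zero_iff {P Q : Matrix (Fin 5) (Fin 5) ℂ} (hP : P.det ≠ 0)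
    (hQ : Q.det ≠ 0) (e : Fin 3 ⊕ Fin 2 ≃ Fin 5) (M : Matrix (Fin 5) (Fin 5) ℂ) :
    (transform P Q e M).det = 0 ↔ M.det = 0 := by
  change ((P * M * Q).submatrix e e).det = 0 ↔ _
  rw [det_submatrix_equiv_self, det_mul, det_mul]
  simp [hP, hQ]

/-- Vectors in the kernel and the cokernel of the normal form pull back to the original matrix. -/
theorem exists_frames {P Q M : Matrix (Fin 5) (Fin 5) ℂ} (hP : P.det ≠ 0)
    (hQ : Q.det ≠ 0) {e : Fin 3 ⊕ Fin 2 ≃ Fin 5} {D : Fin 3 ⊕ Fin 2 → ℂ}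
    (h : transform P Q e M = diagonal D) {p q : Type} [Fintype p] [Fintype q] [DecidableEq p]
    [DecidableEq q] (r : p ↪ Fin 3 ⊕ Fin 2) (s : q ↪ Fin 3 ⊕ Fin 2) (hr : ∀ i, D (r i) = 0)
    (hs : ∀ i, D (s i) = 0) :
    ∃ (R : Matrix (Fin 5) p ℂ) (R' : Matrix p (Fin 5) ℂ) (E : Matrix q (Fin 5) ℂ)
      (E' : Matrix (Fin 5) q ℂ), M * R = 0 ∧ E * M = 0 ∧ R' * R = 1 ∧ E * E' = 1 ∧
      ∀ B i j, (E * B * R) i j = transform P Q e B (s i) (r j) := by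
  have hPu : IsUnit P.det := isUnit_iff_ne_zero.2 hP
  have hQu : IsUnit Q.det := isUnit_iff_ne_zero.2 hQ
  have hsub : ∀ x z, (P * M * Q) (e x) (e z) = diagonal D x z := fun x z =>
    congrFun (congrFun h x) z
  have hcol : ∀ i x, (P * M * Q) x (e (r i)) = 0 := by
    intro i x
    have := hsub (e.symm x) (r i)
    rw [e.apply_symm_apply] at this
    rw [this, diagonal_apply]
    split_ifs with hx
    · rw [hx, hr]
    · rfl
  have hrow : ∀ i x, (P * M * Q) (e (s i)) x = 0 := by
    intro i x
    have := hsub (s i) (e.symm x)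
    rw [e.apply_symm_apply] at this
    rw [this, diagonal_apply]
    split_ifs with hx
    · rw [hs]
    · rfl
  refine ⟨Q.submatrix id (fun i => e (r i)), Q⁻¹.submatrix (fun i => e (r i)) id,
    P.submatrix (fun i => e (s i)) id, P⁻¹.submatrix id (fun i => e (s i)), ?_, ?_, ?_, ?_, ?_⟩
  · have h1 : P * (M * Q.submatrix id (fun i => e (r i))) = 0 := by
      ext x i
      rw [← Matrix.mul_assoc]
      exact hcol i x
    calc _ = P⁻¹ * (P * (M * Q.submatrix id (fun i => e (r i)))) := by
          rw [← Matrix.mul_assoc P⁻¹, nonsing_inv_mul _ hPu, Matrix.one_mul]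
      _ = 0 := by rw [h1, Matrix.mul_zero]
  · have h1 : P.submatrix (fun i => e (s i)) id * M * Q = 0 := by
      ext i x
      exact hrow i x
    calc _ = P.submatrix (fun i => e (s i)) id * M * Q * Q⁻¹ := by
          rw [Matrix.mul_assoc _ Q, mul_nonsing_inv _ hQu, Matrix.mul_one]
      _ = 0 := by rw [h1, Matrix.zero_mul]
  · ext i j
    change (Q⁻¹ * Q) (e (r i)) (e (r j)) = _
    rw [nonsing_inv_mul _ hQu, one_apply, one_apply]
    simp
  · ext i j
    change (P * P⁻¹) (e (s i)) (e (s j)) = _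
    rw [mul_nonsing_inv _ hPu, one_apply, one_apply]
    simp
  · intro B i j
    rfl

/-- A linear system of dimension at most three that is transversal to the rank strata contains no
matrix of corank two. -/
theorem exists_annihilates_of_adjugate_eq_zero {A : Fin 4 → Matrix (Fin 5) (Fin 5) ℂ}
    {y : Fin 4 → ℂ} (hy : y ≠ 0) (h : (pencil A y).adjugate = 0) :
    ∃ N, N ≠ 0 ∧ Annihilates A y N := by
  obtain ⟨P, Q, e, d, hP, hQ, hd⟩ := exists_normalForm h
  obtain ⟨R, R', E, E', h1, h2, h3, h4, -⟩ := exists_frames (M := pencil A y) hP hQ (e := e)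
    (D := Sum.elim d 0) (by rw [← fromBlocks_diagonal]; exact hd.trans (by simp))
    (Function.Embedding.inr : Fin 2 ↪ Fin 3 ⊕ Fin 2) (Function.Embedding.inr : Fin 2 ↪ Fin 3 ⊕ Fin 2)
    (by simp) (by simp)
  exact exists_annihilates_of_card_le hy h1 h2 h3 h4 (by simp)

/-- At a transversal point of corank at least two the corank is exactly two, and the lower right
block gives local coordinates. -/
theorem exists_transversal_normalForm {A : Fin 5 → Matrix (Fin 5) (Fin 5) ℂ} {y : Fin 5 → ℂ}
    (hy : y ≠ 0) (h : (pencil A y).adjugate = 0) (hN : ∀ N, Annihilates A y N → N = 0) :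
    ∃ (P Q : Matrix (Fin 5) (Fin 5) ℂ) (e : Fin 3 ⊕ Fin 2 ≃ Fin 5) (d : Fin 3 → ℂ),
      P.det ≠ 0 ∧ Q.det ≠ 0 ∧ transform P Q e (pencil A y) = fromBlocks (diagonal d) 0 0 0 ∧
      (∀ a, d a ≠ 0) ∧
      ∀ v, (transform P Q e (pencil A v)).toBlocks₂₂ = 0 → ∃ c : ℂ, v = c • y := by
  obtain ⟨P, Q, e, d, hP, hQ, hd⟩ := exists_normalForm h
  have hd' : transform P Q e (pencil A y) = diagonal (Sum.elim d 0) := by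
    rw [← fromBlocks_diagonal]; exact hd.trans (by simp)
  refine ⟨P, Q, e, d, hP, hQ, hd, ?_, ?_⟩
  -- One more zero on the diagonal would give a three-dimensional kernel; with a two-dimensional
  -- piece of the cokernel, 3 · 2 ≥ 5 forces an annihilator.
  · intro a ha
    let r : Fin 1 ⊕ Fin 2 ↪ Fin 3 ⊕ Fin 2 :=
      ⟨Sum.map (fun _ => a) id, by
        rintro (x | x) (z | z) hxz
        · rw [Subsingleton.elim x z]
        · simp at hxz
        · simp at hxz
        · simpa using hxz⟩
    obtain ⟨R, R', E, E', h1, h2, h3, h4, -⟩ := exists_frames hP hQ hd' r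
      (Function.Embedding.inr : Fin 2 ↪ Fin 3 ⊕ Fin 2)
      (by rintro (x | x); exacts [ha, rfl]) (by simp)
    obtain ⟨N, hN0, hNA⟩ := exists_annihilates_of_card_le hy h1 h2 h3 h4 (by simp)
    exact hN0 (hN N hNA)
  · obtain ⟨R, R', E, E', h1, h2, h3, h4, h5⟩ := exists_frames hP hQ hd'
      (Function.Embedding.inr : Fin 2 ↪ Fin 3 ⊕ Fin 2)
      (Function.Embedding.inr : Fin 2 ↪ Fin 3 ⊕ Fin 2) (by simp) (by simp)
    let B : Matrix (Fin 5) (Fin 2 × Fin 2) ℂ := Matrix.of fun k ij => (E * A k * R) ij.1 ij.2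
    have hB : ∀ v, (transform P Q e (pencil A v)).toBlocks₂₂ = 0 ↔ Bᵀ *ᵥ v = 0 := by
      intro v
      have h6 : ∀ i j, (transform P Q e (pencil A v)).toBlocks₂₂ i j = (Bᵀ *ᵥ v) (i, j) := by
        intro i j
        have h7 := h5 (pencil A v) i j
        refine h7.symm.trans ?_
        rw [pencil, Matrix.mul_sum, Matrix.sum_mul, Matrix.sum_apply]
        simp [mulVec, dotProduct, B, mul_comm]
      constructor
      · intro h8
        ext ij
        rw [← h6 ij.1 ij.2, h8]; rfl
      · intro h8
        ext i j
        rw [h6, h8]; rfl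
    -- The absence of annihilators is exactly injectivity of the transpose of v ↦ lower right block.
    -- That map therefore has rank 4 on a five-dimensional space, and its kernel is the line through
    -- `y`.
    have hinj : Function.Injective B.mulVecLin := by
      rw [← LinearMap.ker_eq_bot, LinearMap.ker_eq_bot']
      intro c hc
      let c' : Matrix (Fin 2) (Fin 2) ℂ := Matrix.of fun i j => c (j, i)
      have hz : R * c' * E = 0 := by
        apply hN
        refine ⟨?_, ?_, fun k => ?_⟩
        · rw [← Matrix.mul_assoc, ← Matrix.mul_assoc, h1, Matrix.zero_mul, Matrix.zero_mul]
        · rw [Matrix.mul_assoc, h2, Matrix.mul_zero]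
        · have h9 := congrFun hc k
          rw [Matrix.mul_assoc, Matrix.mul_assoc, Matrix.trace_mul_comm, Matrix.mul_assoc,
            Matrix.trace_mul_comm]
          refine Eq.trans ?_ h9
          simp [Matrix.trace, Matrix.mul_apply (M := E * A k * R), mulVec, dotProduct, B,
            Fintype.sum_prod_type, c']
      have hc0 : c' = 0 := by
        calc c' = R' * R * c' * (E * E') := by rw [h3, h4, Matrix.one_mul, Matrix.mul_one]
          _ = R' * (R * c' * E) * E' := by simp only [Matrix.mul_assoc]
          _ = 0 := by rw [hz, Matrix.mul_zero, Matrix.zero_mul]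
      ext ij
      exact congrFun (congrFun hc0 ij.2) ij.1
    have hrank : Bᵀ.rank = 4 := by
      rw [Matrix.rank_transpose, Matrix.rank, LinearMap.finrank_range_of_inj hinj]
      simp
    have hker : Module.finrank ℂ (LinearMap.ker Bᵀ.mulVecLin) = 1 := by
      have := LinearMap.finrank_range_add_finrank_ker Bᵀ.mulVecLin
      rw [Matrix.rank] at hrank
      simp only [Module.finrank_fintype_fun_eq_card, Fintype.card_fin] at this
      omega
    have hyk : y ∈ LinearMap.ker Bᵀ.mulVecLin := by
      rw [LinearMap.mem_ker, mulVecLin_apply, ← hB, hd']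
      ext i j
      simp [toBlocks₂₂, diagonal_apply]
    intro v hv
    have hvk : v ∈ LinearMap.ker Bᵀ.mulVecLin := by
      rw [LinearMap.mem_ker, mulVecLin_apply, ← hB, hv]
    obtain ⟨c, hc⟩ := (finrank_eq_one_iff_of_nonzero' (⟨y, hyk⟩ : LinearMap.ker Bᵀ.mulVecLin)
      (by simpa using hy)).1 hker ⟨v, hvk⟩
    exact ⟨c, (congrArg Subtype.val hc).symm⟩

end LocalChart

/-! ### Analytic local coordinates given by the Schur complement -/

section LocalChart

open Matrix
open scoped ContDiff

theorem pencil_add {κ n R : Type} [Fintype κ] [CommRing R] (A : κ → Matrix n n R) (y z : κ → R) :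
    pencil A (y + z) = pencil A y + pencil A z := by
  simp [pencil, add_smul, Finset.sum_add_distrib]

theorem pencil_smul {κ n R : Type} [Fintype κ] [CommRing R] (A : κ → Matrix n n R) (c : R)
    (y : κ → R) : pencil A (c • y) = c • pencil A y := by
  simp [pencil, mul_smul, Finset.smul_sum]

theorem contDiff_scaledSchur {E : Type} [NormedAddCommGroup E] [NormedSpace ℂ E]
    {G : E → Matrix (Fin 3 ⊕ Fin 2) (Fin 3 ⊕ Fin 2) ℂ}
    (hG : ∀ i j, ContDiff ℂ ω (fun x => G x i j)) (i j : Fin 2) :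
    ContDiff ℂ ω (fun x => scaledSchur (G x) i j) := by
  simp only [scaledSchur, det_fin_three, adjugate_fin_three, Matrix.sub_apply, Matrix.smul_apply,
    Matrix.mul_apply, Fin.sum_univ_three, toBlocks₁₁, toBlocks₁₂, toBlocks₂₁, toBlocks₂₂,
    Matrix.of_apply, smul_eq_mul]
  simp
  fun_prop

/-- The slice through `y` on which the first coordinate is constant. -/
def slice (y : Fin 5 → ℂ) (v : Fin 4 → ℂ) : Fin 5 → ℂ := y + Fin.cons 0 v

/-- Near a transversal point of corank two, with nonzero first coordinate, the pencils in a line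
through `A` are described by the scaled Schur complement. -/
theorem exists_local_chart {A : Fin 5 → Matrix (Fin 5) (Fin 5) ℂ} {y : Fin 5 → ℂ}
    (hy : y 0 ≠ 0) (h : (pencil A y).adjugate = 0) (hN : ∀ N, Annihilates A y N → N = 0)
    (B : Fin 5 → Matrix (Fin 5) (Fin 5) ℂ) :
    ∃ S : ℂ × (Fin 4 → ℂ) → (Fin 2 × Fin 2 → ℂ), ContDiff ℂ ω S ∧ S 0 = 0 ∧
      (∀ w, fderiv ℂ S 0 (0, w) = 0 → w = 0) ∧
      ∀ᶠ x in 𝓝 (0 : ℂ × (Fin 4 → ℂ)),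
        ((pencil (A + x.1 • B) (slice y x.2)).adjugate = 0 ↔ S x = 0) ∧
        ((pencil (A + x.1 • B) (slice y x.2)).det = 0 ↔
          S x (0, 0) * S x (1, 1) - S x (0, 1) * S x (1, 0) = 0) := by
  have hy0 : y ≠ 0 := fun h => hy (by simp [h])
  obtain ⟨P, Q, e, d, hP, hQ, hd, hd0, hker⟩ := exists_transversal_normalForm hy0 h hN
  let G : ℂ × (Fin 4 → ℂ) → Matrix (Fin 3 ⊕ Fin 2) (Fin 3 ⊕ Fin 2) ℂ := fun x =>
    transform P Q e (pencil (A + x.1 • B) (slice y x.2))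
  have hG : ∀ i j, ContDiff ℂ ω (fun x => G x i j) := by
    intro i j
    have : ∀ k : Fin 5, ContDiff ℂ ω (fun x : ℂ × (Fin 4 → ℂ) => slice y x.2 k) := by
      intro k
      refine Fin.cases ?_ (fun k => ?_) k
      · simp only [slice, Pi.add_apply, Fin.cons_zero]; fun_prop
      · simp only [slice, Pi.add_apply, Fin.cons_succ]; fun_prop
    simp only [G, transform, LinearMap.coe_mk, AddHom.coe_mk, Matrix.submatrix_apply,
      Matrix.mul_apply, pencil_apply, Pi.add_apply, Pi.smul_apply, Matrix.add_apply,
      Matrix.smul_apply]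
    fun_prop
  have hG0 : G 0 = fromBlocks (diagonal d) 0 0 0 := by
    have hs : slice y 0 = y := by
      ext k; refine Fin.cases ?_ (fun k => ?_) k <;> simp [slice]
    simpa [G, hs] using hd
  let S : ℂ × (Fin 4 → ℂ) → (Fin 2 × Fin 2 → ℂ) := fun x ij => scaledSchur (G x) ij.1 ij.2
  have hS : ContDiff ℂ ω S := contDiff_pi.2 fun ij => contDiff_scaledSchur hG ij.1 ij.2
  have hdet : (diagonal d).det ≠ 0 := by
    rw [det_diagonal]; exact Finset.prod_ne_zero_iff.2 fun a _ => hd0 a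
  refine ⟨S, hS, ?_, ?_, ?_⟩
  · ext ij
    simp [S, scaledSchur, hG0]
  · intro w hw
    set V := transform P Q e (pencil A (Fin.cons 0 w)) with hV
    have hline : ∀ s : ℂ, G (s • (0, w)) = fromBlocks (diagonal d) 0 0 0 + s • V := by
      intro s
      have : slice y (s • w) = y + s • (Fin.cons 0 w : Fin 5 → ℂ) := by
        ext k; refine Fin.cases ?_ (fun k => ?_) k <;> simp [slice]
      simp only [G, Prod.smul_mk, smul_zero, zero_smul, add_zero, this, pencil_add, pencil_smul,
        map_add, map_smul, hd, hV]
    -- Along s ↦ s(0, w) the off-diagonal blocks are of order s, so the correction term of the Schur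
    -- complement is of order s². The derivative at 0 is thus det(diagonal d) times the lower right
    -- block of `V`.
    have hV0 : V.toBlocks₂₂ = 0 := by
      ext i j
      let g : ℂ → ℂ := fun s => (diagonal d + s • V.toBlocks₁₁).det * V.toBlocks₂₂ i j -
        s * (V.toBlocks₂₁ * (diagonal d + s • V.toBlocks₁₁).adjugate * V.toBlocks₁₂) i j
      have hg : ∀ s, S (s • (0, w)) (i, j) = s * g s := by
        intro s
        have hb : fromBlocks (diagonal d) 0 0 0 + s • V =
            fromBlocks (diagonal d + s • V.toBlocks₁₁) (s • V.toBlocks₁₂) (s • V.toBlocks₂₁)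
              (s • V.toBlocks₂₂) := by
          conv_lhs => rw [← fromBlocks_toBlocks V]
          rw [fromBlocks_smul, fromBlocks_add]
          simp
        simp only [S, hline, hb, scaledSchur, toBlocks_fromBlocks₁₁, toBlocks_fromBlocks₁₂,
          toBlocks_fromBlocks₂₁, toBlocks_fromBlocks₂₂, g, Matrix.sub_apply, Matrix.smul_apply,
          Matrix.smul_mul, Matrix.mul_smul, smul_eq_mul]
        ring
      have hgd : Differentiable ℂ g := by
        simp only [g, det_fin_three, adjugate_fin_three, Matrix.mul_apply, Fin.sum_univ_three]
        simp
        fun_prop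
      have h1 : HasDerivAt (fun s : ℂ => s * g s) (g 0) 0 := by
        have : HasDerivAt (fun s : ℂ => s * g s) (1 * g 0 + 0 * deriv g 0) 0 :=
          (hasDerivAt_id' (0 : ℂ)).mul (hgd 0).hasDerivAt
        simpa using this
      have h2 : HasDerivAt (fun s : ℂ => S (s • ((0 : ℂ), w)) (i, j)) 0 0 := by
        have hSd : HasFDerivAt S (fderiv ℂ S 0) ((0 : ℂ) • ((0 : ℂ), w)) := by
          rw [zero_smul]
          exact (hS.differentiable (by simp) 0).hasFDerivAt
        have hl : HasDerivAt (fun s : ℂ => s • ((0 : ℂ), w)) ((1 : ℂ) • ((0 : ℂ), w)) 0 :=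
          (hasDerivAt_id (0 : ℂ)).smul_const _
        have := hSd.comp_hasDerivAt (0 : ℂ) hl
        rw [one_smul, hw] at this
        exact (hasDerivAt_pi.1 this) (i, j)
      simp only [hg] at h2
      have h3 : g 0 = 0 := h1.unique h2
      simp only [g, zero_smul, add_zero, zero_mul, sub_zero] at h3
      exact (mul_eq_zero.1 h3).resolve_left hdet
    -- The direction is a multiple of `y` with first coordinate 0; since y 0 ≠ 0, it is zero.
    obtain ⟨c, hc⟩ := hker _ hV0
    have hc0 : c = 0 := by
      have := congrFun hc 0
      simpa [hy] using this.symm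
    ext k
    have := congrFun hc k.succ
    simpa [hc0] using this
  · have hcont : Continuous (fun x => (G x).toBlocks₁₁.det) := by
      apply Continuous.matrix_det
      exact continuous_matrix fun i j => (hG (Sum.inl i) (Sum.inl j)).continuous
    have hne : (G 0).toBlocks₁₁.det ≠ 0 := by
      rw [hG0, toBlocks_fromBlocks₁₁]; exact hdet
    filter_upwards [hcont.continuousAt.eventually_ne hne] with x hx
    obtain ⟨h1, h2⟩ := scaledSchur_iff hx
    rw [← adjugate_transform_eq_zero_iff hP hQ e, ← det_transform_eq_zero_iff hP hQ e, h1, h2,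
      det_fin_two]
    refine ⟨⟨fun h => ?_, fun h => ?_⟩, Iff.rfl⟩
    · ext ij; simp [S, h]
    · ext i j; exact congrFun h (i, j)

end LocalChart

/-! ### Inverse function theorem -/

section LocalInverse

open scoped ContDiff

/-- The inverse function theorem for analytic maps between spaces of the same dimension. -/
theorem exists_local_inverse {E F : Type} [NormedAddCommGroup E] [NormedSpace ℂ E]
    [FiniteDimensional ℂ E] [NormedAddCommGroup F] [NormedSpace ℂ F] [FiniteDimensional ℂ F]
    (hfin : Module.finrank ℂ E = Module.finrank ℂ F) {f : E → F} (hf : ContDiff ℂ ω f)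
    (hf0 : f 0 = 0) (hinj : ∀ w, fderiv ℂ f 0 w = 0 → w = 0) :
    ∃ g : F → E, ContDiffAt ℂ ω g 0 ∧ g 0 = 0 ∧ (∀ᶠ z in 𝓝 0, f (g z) = z) ∧
      (∀ᶠ x in 𝓝 0, g (f x) = x) ∧ ∀ z, fderiv ℂ g 0 z = 0 → z = 0 := by
  have : CompleteSpace E := FiniteDimensional.complete ℂ E
  let e : E ≃L[ℂ] F := (LinearEquiv.ofInjectiveOfFinrankEq (fderiv ℂ f 0 : E →ₗ[ℂ] F)
    (LinearMap.ker_eq_bot.1 (LinearMap.ker_eq_bot'.2 hinj)) hfin).toContinuousLinearEquiv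
  have hfe : HasFDerivAt f (e : E →L[ℂ] F) 0 := by
    have h1 : (e : E →L[ℂ] F) = fderiv ℂ f 0 := by ext; rfl
    rw [h1]
    exact (hf.differentiable (by simp) 0).hasFDerivAt
  have hfa : ContDiffAt ℂ ω f 0 := hf.contDiffAt
  have hs := hfa.hasStrictFDerivAt' hfe (by simp)
  refine ⟨hs.localInverse f e 0, ?_, ?_, ?_, hs.eventually_left_inverse, ?_⟩
  · have := hfa.to_localInverse hfe (by simp)
    rwa [hf0] at this
  · have := hs.localInverse_apply_image
    rwa [hf0] at this
  · have := hs.eventually_right_inverse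
    rwa [hf0] at this
  · have := hs.to_localInverse.hasFDerivAt.fderiv
    rw [hf0] at this
    intro z hz
    rw [this] at hz
    simpa using hz

end LocalInverse

/-! ### Ordinary double points -/

section DoublePoint

open Matrix
open scoped ContDiff

theorem mem_cone_iff {A : Fin 5 → Matrix (Fin 5) (Fin 5) ℂ} {v : Fin 5 → ℂ} :
    v ∈ cone {y : ℙ ℂ (Fin 5 → ℂ) | Matrix.det (∑ k, y.rep k • A k) = 0} ↔
      v ≠ 0 ∧ (pencil A v).det = 0 := by
  refine ⟨fun ⟨hv, h⟩ => ⟨hv, ?_⟩, fun ⟨hv, h⟩ => ⟨hv, ?_⟩⟩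
  all_goals
    obtain ⟨a, ha⟩ := Projectivization.exists_smul_eq_mk_rep ℂ v hv
    have h1 : ∑ k, (Projectivization.mk ℂ v hv).rep k • A k = (a : ℂ) • pencil A v := by
      rw [← pencil_smul, ← ha]; rfl
  · rw [Set.mem_ofPred_eq, h1, det_smul] at h
    exact (mul_eq_zero.1 h).resolve_left (pow_ne_zero _ a.ne_zero)
  · rw [Set.mem_ofPred_eq, h1, det_smul, h, mul_zero]

/-- Coordinates in which the determinant of a matrix with two rows is a sum of squares. -/
def detCoordinates : (Fin 4 → ℂ) →L[ℂ] (Fin 2 × Fin 2 → ℂ) :=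
  LinearMap.toContinuousLinearMap
    { toFun := fun x ij => !![x 0 + Complex.I * x 1, x 2 + Complex.I * x 3;
        -(x 2 - Complex.I * x 3), x 0 - Complex.I * x 1] ij.1 ij.2
      map_add' := fun x z => by
        ext ⟨i, j⟩
        fin_cases i <;> fin_cases j <;> simp <;> ring
      map_smul' := fun c x => by
        ext ⟨i, j⟩
        fin_cases i <;> fin_cases j <;> simp <;> ring }

theorem detCoordinates_det (x : Fin 4 → ℂ) :
    detCoordinates x (0, 0) * detCoordinates x (1, 1) -
      detCoordinates x (0, 1) * detCoordinates x (1, 0) = ∑ i, x i ^ 2 := by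
  simp [detCoordinates, Fin.sum_univ_four]
  linear_combination (-(x 1 ^ 2) - x 3 ^ 2) * Complex.I_sq

theorem detCoordinates_injective {x : Fin 4 → ℂ} (h : detCoordinates x = 0) : x = 0 := by
  have h00 := congrFun h (0, 0)
  have h01 := congrFun h (0, 1)
  have h10 := congrFun h (1, 0)
  have h11 := congrFun h (1, 1)
  simp [detCoordinates] at h00 h01 h10 h11
  have e0 : x 0 = 0 := by linear_combination (h00 + h11) / 2
  have e1 : Complex.I * x 1 = 0 := by linear_combination (h00 - h11) / 2
  have e2 : x 2 = 0 := by linear_combination (h01 - h10) / 2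
  have e3 : Complex.I * x 3 = 0 := by linear_combination (h01 + h10) / 2
  simp at e1 e3
  ext i
  fin_cases i <;> simp [*]

/-- Transversal points of corank two are ordinary double points. -/
theorem isOrdinaryDoublePoint_of_transversal {A : Fin 5 → Matrix (Fin 5) (Fin 5) ℂ}
    {p : ℙ ℂ (Fin 5 → ℂ)} (hp : p.rep 0 ≠ 0) (h : (pencil A p.rep).adjugate = 0)
    (hN : ∀ N, Annihilates A p.rep N → N = 0) :
    IsOrdinaryDoublePoint {y : ℙ ℂ (Fin 5 → ℂ) | Matrix.det (∑ k, y.rep k • A k) = 0} p := by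
  obtain ⟨S, hS, hS0, hSd, hSe⟩ := exists_local_chart hp h hN 0
  let s : (Fin 4 → ℂ) → (Fin 2 × Fin 2 → ℂ) := fun v => S (0, v)
  have hs : ContDiff ℂ ω s := by
    apply hS.comp
    fun_prop
  have hsd : ∀ w, fderiv ℂ s 0 w = fderiv ℂ S 0 (0, w) := by
    intro w
    have h1 : HasFDerivAt s ((fderiv ℂ S 0).comp (ContinuousLinearMap.inr ℂ ℂ (Fin 4 → ℂ))) 0 :=
      HasFDerivAt.comp (g := S) (f := fun v : Fin 4 → ℂ => ((0 : ℂ), v)) 0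
        (hS.differentiable (by simp) 0).hasFDerivAt (hasFDerivAt_prodMk_right (0 : ℂ) _)
    rw [h1.fderiv]
    rfl
  obtain ⟨g, hg, hg0, hgr, -, hgd⟩ := exists_local_inverse (by simp) hs hS0
    (fun w hw => hSd w (by rw [← hsd, hw]))
  have hΛ : Continuous detCoordinates := detCoordinates.continuous
  have hgΛ : ContDiffAt ℂ ω (fun x => g (detCoordinates x)) 0 := by
    have h1 : ContDiffAt ℂ ω g (detCoordinates 0) := by rwa [map_zero]
    exact h1.comp 0 detCoordinates.contDiff.contDiffAt
  let ι : (Fin 4 → ℂ) →L[ℂ] (Fin 5 → ℂ) := LinearMap.toContinuousLinearMap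
    { toFun := fun v => Fin.cons 0 v
      map_add' := fun v w => by
        ext k; refine Fin.cases ?_ (fun k => ?_) k <;> simp
      map_smul' := fun c w => by
        ext k; refine Fin.cases ?_ (fun k => ?_) k <;> simp }
  -- The inverse `g` of the chart straightens the block entries, and `detCoordinates` turns their
  -- determinant into the sum of squares.
  refine ⟨fun x => slice p.rep (g (detCoordinates x)), ?_, ?_, ?_, ?_⟩
  · refine ContDiffAt.analyticAt ?_
    exact contDiffAt_const.add (ι.contDiff.contDiffAt.comp 0 hgΛ)
  · ext k
    refine Fin.cases ?_ (fun k => ?_) k <;> simp [slice, hg0]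
  · intro x hx
    have h1 : HasFDerivAt (fun x => slice p.rep (g (detCoordinates x)))
        (ι.comp ((fderiv ℂ g 0).comp detCoordinates)) 0 := by
      have h2 : HasFDerivAt g (fderiv ℂ g 0) (detCoordinates 0) := by
        rw [map_zero]
        exact (hg.differentiableAt (by simp)).hasFDerivAt
      exact (ι.hasFDerivAt.comp 0 (h2.comp 0 detCoordinates.hasFDerivAt)).const_add _
    -- The image of the derivative has first coordinate 0, so it meets the line of `p` only in 0.
    rw [h1.fderiv, Projectivization.submodule_eq, Submodule.mem_span_singleton] at hx
    obtain ⟨c, hc⟩ := hx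
    have hc0 : c = 0 := by
      have := congrFun hc 0
      simpa [ι, hp] using this
    rw [hc0, zero_smul] at hc
    apply detCoordinates_injective
    apply hgd
    ext k
    have := congrFun hc k.succ
    simpa [ι] using this.symm
  · have t1 : Filter.Tendsto (fun x => detCoordinates x) (𝓝 0) (𝓝 0) := by
      simpa using hΛ.tendsto 0
    have t2 : Filter.Tendsto (fun x => ((0 : ℂ), g (detCoordinates x))) (𝓝 0) (𝓝 0) := by
      have h1 : ContinuousAt (fun x => ((0 : ℂ), g (detCoordinates x))) 0 :=
        continuousAt_const.prodMk hgΛ.continuousAt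
      simp only [ContinuousAt, map_zero, hg0] at h1
      exact h1
    filter_upwards [t1.eventually hgr, t2.eventually hSe] with x hx1 hx2
    rw [mem_cone_iff, ← detCoordinates_det]
    have h3 := hx2.2
    rw [show S (0, g (detCoordinates x)) = detCoordinates x from hx1] at h3
    rw [← h3]
    simp only [smul_zero, add_zero, and_iff_right_iff_imp]
    intro _ h0
    exact hp (by simpa [slice] using congrFun h0 0)

end DoublePoint

/-! ### Local constancy of the cardinality of fibres -/

section Counting

open Filter

/-- The fibres of a proper family that is locally a section near every point of one fibre have
locally constant cardinality. -/
theorem finite_and_eventually_ncard_eq {T E : Type} [TopologicalSpace T] [TopologicalSpace E]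
    [T2Space E] (Z : T → Set E) (t₀ : T) (hclosed : IsClosed {x : T × E | x.2 ∈ Z x.1})
    {K : Set E} (hK : IsCompact K) (hZK : ∀ᶠ t in 𝓝 t₀, Z t ⊆ K)
    (huniq : ∀ v ∈ Z t₀, ∃ W ∈ 𝓝 v, ∀ᶠ t in 𝓝 t₀, (W ∩ Z t).Subsingleton)
    (hex : ∀ v ∈ Z t₀, ∀ W ∈ 𝓝 v, ∀ᶠ t in 𝓝 t₀, (W ∩ Z t).Nonempty) :
    (Z t₀).Finite ∧ ∀ᶠ t in 𝓝 t₀, (Z t).ncard = (Z t₀).ncard := by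
  choose! W hW hWs using huniq
  have hcompact : IsCompact (Z t₀) :=
    hK.of_isClosed_subset (hclosed.preimage (Continuous.prodMk_right t₀)) hZK.self_of_nhds
  -- Local uniqueness at t₀ itself isolates the points of a compact set.
  have hfin : (Z t₀).Finite := by
    obtain ⟨s, hs, hcov⟩ := hcompact.elim_nhds_subcover W hW
    refine s.finite_toSet.subset fun v hv => ?_
    obtain ⟨x, hx, hvx⟩ := Set.mem_iUnion₂.1 (hcov hv)
    have := (hWs x (hs x hx)).self_of_nhds ⟨hvx, hv⟩ ⟨mem_of_mem_nhds (hW x (hs x hx)), hs x hx⟩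
    rw [this]
    exact hx
  refine ⟨hfin, ?_⟩
  obtain ⟨U, hU, hdisj⟩ := hfin.t2_separation
  let V : E → Set E := fun x => U x ∩ interior (W x)
  have hVn : ∀ x ∈ Z t₀, V x ∈ 𝓝 x := fun x hx =>
    inter_mem ((hU x).2.mem_nhds (hU x).1) (interior_mem_nhds.2 (hW x hx))
  have hC : IsCompact (K \ ⋃ x ∈ Z t₀, V x) :=
    hK.diff (isOpen_biUnion fun x _ => (hU x).2.inter isOpen_interior)
  -- No new points appear away from the old ones, by closedness of the family and compactness of the
  -- remaining part of `K`.
  have h1 : ∀ᶠ t in 𝓝 t₀, ∀ v ∈ K \ ⋃ x ∈ Z t₀, V x, v ∉ Z t := by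
    apply hC.eventually_forall_of_forall_eventually
    intro v hv
    refine hclosed.isOpen_compl.mem_nhds (fun hvZ : v ∈ Z t₀ => hv.2 ?_)
    exact Set.mem_iUnion₂.2 ⟨v, hvZ, mem_of_mem_nhds (hVn v hvZ)⟩
  have h2 : ∀ᶠ t in 𝓝 t₀, ∀ x ∈ Z t₀, (V x ∩ Z t).Nonempty :=
    (eventually_all_finite hfin).2 fun x hx => hex x hx _ (hVn x hx)
  have h3 : ∀ᶠ t in 𝓝 t₀, ∀ x ∈ Z t₀, (W x ∩ Z t).Subsingleton :=
    (eventually_all_finite hfin).2 fun x hx => hWs x hx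
  filter_upwards [h1, h2, h3, hZK] with t h1 h2 h3 h4
  choose! c hc using h2
  symm
  refine Set.ncard_congr (fun x _ => c x) (fun x hx => (hc x hx).2) ?_ ?_
  · intro x y hx hy hxy
    by_contra hne
    have := hdisj hx hy hne
    refine Set.disjoint_left.1 this (hc x hx).1.1 ?_
    change c x = c y at hxy
    rw [hxy]
    exact (hc y hy).1.1
  · intro v hv
    have hvV : v ∈ ⋃ x ∈ Z t₀, V x := by
      by_contra hcon
      exact h1 v ⟨h4 hv, hcon⟩ hv
    obtain ⟨x, hx, hvx⟩ := Set.mem_iUnion₂.1 hvV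
    exact ⟨x, hx, h3 x hx ⟨interior_subset (hc x hx).1.2, (hc x hx).2⟩
      ⟨interior_subset hvx.2, hv⟩⟩

end Counting

/-! ### Invariance of the number of corank-two points under deformation -/

section Degeneracy

open Matrix Filter
open scoped ContDiff

/-- The points of corank at least two in the chart where the first coordinate is one. -/
def degeneracyLocus (A : Fin 5 → Matrix (Fin 5) (Fin 5) ℂ) : Set (Fin 4 → ℂ) :=
  {v | (pencil A (Fin.cons 1 v)).adjugate = 0}

/-- The linear system is transversal to the rank strata at its points of corank at least two, and
none of these points lies in the hyperplane at infinity. -/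
def IsTransversal (A : Fin 5 → Matrix (Fin 5) (Fin 5) ℂ) : Prop :=
  ∀ y, y ≠ 0 → (pencil A y).adjugate = 0 → y 0 ≠ 0 ∧ ∀ N, Annihilates A y N → N = 0

theorem cons_one_ne_zero (v : Fin 4 → ℂ) : (Fin.cons 1 v : Fin 5 → ℂ) ≠ 0 := fun h =>
  one_ne_zero (congrFun h 0)

theorem slice_cons_one (v u : Fin 4 → ℂ) :
    slice (Fin.cons 1 v) u = Fin.cons 1 (v + u) := by
  ext k
  refine Fin.cases ?_ (fun k => ?_) k <;> simp [slice]

theorem continuous_adjugate_pencil (A B : Fin 5 → Matrix (Fin 5) (Fin 5) ℂ) :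
    Continuous (fun x : ℂ × (Fin 5 → ℂ) => (pencil (A + x.1 • B) x.2).adjugate) := by
  apply Continuous.matrix_adjugate
  simp only [pencil, Pi.add_apply, Pi.smul_apply]
  fun_prop

/-- In the coordinates (t, S(t, u)) the degeneracy loci of the whole family are given near v by S =
0. Since these are local coordinates on the product, there is one nearby point for each small t. -/
theorem persistence {A : Fin 5 → Matrix (Fin 5) (Fin 5) ℂ} (hA : IsTransversal A)
    (B : Fin 5 → Matrix (Fin 5) (Fin 5) ℂ) {v : Fin 4 → ℂ} (hv : v ∈ degeneracyLocus A) :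
    (∃ W ∈ 𝓝 v, ∀ᶠ t in 𝓝 (0 : ℂ), (W ∩ degeneracyLocus (A + t • B)).Subsingleton) ∧
    ∀ W ∈ 𝓝 v, ∀ᶠ t in 𝓝 (0 : ℂ), (W ∩ degeneracyLocus (A + t • B)).Nonempty := by
  obtain ⟨hy, hN⟩ := hA _ (cons_one_ne_zero v) hv
  obtain ⟨S, hS, hS0, hSd, hSe⟩ := exists_local_chart hy hv hN B
  let Φ : ℂ × (Fin 4 → ℂ) → ℂ × (Fin 2 × Fin 2 → ℂ) := fun x => (x.1, S x)
  have hΦ : ContDiff ℂ ω Φ := contDiff_fst.prodMk hS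
  have hΦ0 : Φ 0 = 0 := by simp [Φ, hS0]
  have hΦd : ∀ w, fderiv ℂ Φ 0 w = 0 → w = 0 := by
    intro w hw
    have h1 : HasFDerivAt Φ ((ContinuousLinearMap.fst ℂ ℂ (Fin 4 → ℂ)).prod (fderiv ℂ S 0)) 0 :=
      hasFDerivAt_fst.prodMk (hS.differentiable (by simp) 0).hasFDerivAt
    rw [h1.fderiv] at hw
    have hw1 : w.1 = 0 := congrArg Prod.fst hw
    have hw2 : fderiv ℂ S 0 w = 0 := congrArg Prod.snd hw
    have hw3 : w = (0, w.2) := by rw [← hw1]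
    rw [hw3] at hw2
    rw [hw3, hSd _ hw2]
    rfl
  obtain ⟨g, hg, hg0, hgr, hgl, -⟩ := exists_local_inverse (by simp) hΦ hΦ0 hΦd
  have hmem : ∀ (t : ℂ) (u : Fin 4 → ℂ), v + u ∈ degeneracyLocus (A + t • B) ↔
      (pencil (A + t • B) (slice (Fin.cons 1 v) u)).adjugate = 0 := by
    intro t u
    rw [slice_cons_one]
    rfl
  constructor
  · obtain ⟨V, hV, W, hW, hVW⟩ := mem_nhds_prod_iff.1 (hgl.and hSe)
    have hsub : Tendsto (fun u => u - v) (𝓝 v) (𝓝 0) := by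
      have : Continuous (fun u : Fin 4 → ℂ => u - v) := by fun_prop
      simpa using this.tendsto v
    refine ⟨_, hsub hW, ?_⟩
    filter_upwards [hV] with t ht
    have key : ∀ u, u ∈ (fun u => u - v) ⁻¹' W ∩ degeneracyLocus (A + t • B) →
        g (t, 0) = (t, u - v) := by
      rintro u ⟨hu1, hu2⟩
      have h1 := hVW (Set.mk_mem_prod ht hu1)
      have h2 := (hmem t (u - v)).1 (by simpa using hu2)
      have h3 := h1.2.1.1 h2
      have h4 := h1.1
      simp only [Φ, h3] at h4
      exact h4
    intro u hu u' hu'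
    have := (key u hu).symm.trans (key u' hu')
    simpa using this
  · intro W hW
    have hgt : Tendsto (fun t : ℂ => g (t, 0)) (𝓝 0) (𝓝 0) := by
      have h1 : ContinuousAt g ((0 : ℂ), (0 : Fin 2 × Fin 2 → ℂ)) := hg.continuousAt
      have h2 : Tendsto (fun t : ℂ => (t, (0 : Fin 2 × Fin 2 → ℂ))) (𝓝 0) (𝓝 (0, 0)) :=
        (Continuous.prodMk_left _).tendsto _
      have h3 := h1.tendsto.comp h2
      rwa [show g ((0 : ℂ), (0 : Fin 2 × Fin 2 → ℂ)) = 0 from hg0] at h3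
    have hpt : Tendsto (fun t : ℂ => (t, (0 : Fin 2 × Fin 2 → ℂ))) (𝓝 0) (𝓝 0) :=
      (Continuous.prodMk_left _).tendsto _
    have hW' : Tendsto (fun x : ℂ × (Fin 4 → ℂ) => v + x.2) (𝓝 0) (𝓝 v) := by
      have : Continuous (fun x : ℂ × (Fin 4 → ℂ) => v + x.2) := by fun_prop
      simpa using this.tendsto 0
    filter_upwards [hpt.eventually hgr, hgt.eventually hSe, (hW'.comp hgt) hW] with t h1 h2 h3
    have h4 : (g (t, 0)).1 = t := congrArg Prod.fst h1
    have h5 : S (g (t, 0)) = 0 := congrArg Prod.snd h1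
    refine ⟨v + (g (t, 0)).2, h3, (hmem _ _).2 ?_⟩
    have h6 := h2.1.2 h5
    rwa [h4] at h6

/-- No point escapes to infinity: on the compact unit sphere the degenerate vectors of A avoid y 0 =
0, so for small t the first coordinate of a degenerate unit vector stays bounded away from 0. -/
theorem eventually_degeneracyLocus_subset {A : Fin 5 → Matrix (Fin 5) (Fin 5) ℂ}
    (hA : IsTransversal A) (B : Fin 5 → Matrix (Fin 5) (Fin 5) ℂ) :
    ∃ r : ℝ, ∀ᶠ t in 𝓝 (0 : ℂ), degeneracyLocus (A + t • B) ⊆ Metric.closedBall 0 r := by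
  have hcont := continuous_adjugate_pencil A B
  have h1 : ∀ᶠ x in 𝓝 ((0 : ℂ), (0 : ℝ)), ∀ y ∈ Metric.sphere (0 : Fin 5 → ℂ) 1,
      (pencil (A + x.1 • B) y).adjugate ≠ 0 ∨ x.2 < ‖y 0‖ := by
    apply (isCompact_sphere (0 : Fin 5 → ℂ) 1).eventually_forall_of_forall_eventually
    intro y hy
    have hy0 : y ≠ 0 := by
      rintro rfl
      simp at hy
    by_cases h : (pencil A y).adjugate = 0
    · have h0 := (hA y hy0 h).1
      have h2 : Continuous (fun z : (ℂ × ℝ) × (Fin 5 → ℂ) => ‖z.2 0‖ - z.1.2) := by fun_prop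
      have h3 : ∀ᶠ z in 𝓝 (((0 : ℂ), (0 : ℝ)), y), 0 < ‖z.2 0‖ - z.1.2 :=
        h2.continuousAt.eventually_const_lt (by simpa using h0)
      filter_upwards [h3] with z hz
      right
      linarith
    · have h2 : Continuous (fun z : (ℂ × ℝ) × (Fin 5 → ℂ) =>
          (pencil (A + z.1.1 • B) z.2).adjugate) :=
        hcont.comp (f := fun z : (ℂ × ℝ) × (Fin 5 → ℂ) => (z.1.1, z.2)) (by fun_prop)
      have h3 : ∀ᶠ z in 𝓝 (((0 : ℂ), (0 : ℝ)), y),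
          (pencil (A + z.1.1 • B) z.2).adjugate ≠ 0 :=
        h2.continuousAt.eventually_ne (by simpa using h)
      filter_upwards [h3] with z hz
      exact Or.inl hz
  obtain ⟨V, hV, U, hU, hVU⟩ := mem_nhds_prod_iff.1 h1
  obtain ⟨ε, hε, hεU⟩ := Metric.mem_nhds_iff.1 hU
  have hεm : ε / 2 ∈ U := hεU (by simp [abs_of_pos hε]; linarith)
  refine ⟨2 / ε, ?_⟩
  filter_upwards [hV] with t ht v hv
  set y : Fin 5 → ℂ := Fin.cons 1 v with hy
  have hyn : 0 < ‖y‖ := norm_pos_iff.2 (cons_one_ne_zero v)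
  set c : ℂ := ((‖y‖⁻¹ : ℝ) : ℂ) with hc
  have hcn : ‖c‖ = ‖y‖⁻¹ := by rw [hc, Complex.norm_real, norm_inv, norm_norm]
  have h2 := hVU (Set.mk_mem_prod ht hεm) (c • y)
    (by simp [norm_smul, hcn, hyn.ne'])
  have h3 : (pencil (A + t • B) (c • y)).adjugate = 0 := by
    rw [pencil_smul, adjugate_smul, show (pencil (A + t • B) y).adjugate = 0 from hv, smul_zero]
  have h4 : ε / 2 < ‖(c • y) 0‖ := h2.resolve_left fun h => h h3
  have h5 : ‖(c • y) 0‖ = ‖y‖⁻¹ := by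
    rw [Pi.smul_apply, show y 0 = 1 from rfl, smul_eq_mul, mul_one, hcn]
  rw [h5] at h4
  have h6 : ‖y‖ ≤ 2 / ε := by
    rw [le_div_iff₀ hε]
    have := mul_lt_mul_of_pos_right h4 hyn
    rw [inv_mul_cancel₀ hyn.ne'] at this
    linarith
  rw [mem_closedBall_zero_iff]
  refine le_trans ?_ h6
  rw [pi_norm_le_iff_of_nonneg hyn.le]
  intro i
  have := norm_le_pi_norm y i.succ
  simpa [hy] using this

/-- The number of points of corank at least two does not change under small deformations along a
line. -/
theorem finite_and_eventually_ncard_degeneracyLocus_eq {A : Fin 5 → Matrix (Fin 5) (Fin 5) ℂ}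
    (hA : IsTransversal A) (B : Fin 5 → Matrix (Fin 5) (Fin 5) ℂ) :
    (degeneracyLocus A).Finite ∧
      ∀ᶠ t in 𝓝 (0 : ℂ), (degeneracyLocus (A + t • B)).ncard = (degeneracyLocus A).ncard := by
  obtain ⟨r, hr⟩ := eventually_degeneracyLocus_subset hA B
  have hclosed : IsClosed {x : ℂ × (Fin 4 → ℂ) | x.2 ∈ degeneracyLocus (A + x.1 • B)} := by
    have hc : Continuous (fun x : ℂ × (Fin 4 → ℂ) =>
        (pencil (A + x.1 • B) (Fin.cons 1 x.2)).adjugate) := by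
      refine (continuous_adjugate_pencil A B).comp
        (f := fun x : ℂ × (Fin 4 → ℂ) => (x.1, (Fin.cons 1 x.2 : Fin 5 → ℂ))) ?_
      refine continuous_fst.prodMk (continuous_pi fun k => ?_)
      refine Fin.cases ?_ (fun k => ?_) k
      · simp only [Fin.cons_zero]; fun_prop
      · simp only [Fin.cons_succ]; fun_prop
    exact isClosed_singleton.preimage hc
  have h0 : degeneracyLocus (A + (0 : ℂ) • B) = degeneracyLocus A := by simp
  have := finite_and_eventually_ncard_eq (fun t : ℂ => degeneracyLocus (A + t • B)) 0 hclosed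
    (isCompact_closedBall 0 r) hr
    (fun v hv => (persistence hA B (h0 ▸ hv)).1) (fun v hv => (persistence hA B (h0 ▸ hv)).2)
  simpa only [h0] using this

/-- Two linear systems joined by a line almost all of whose members are transversal have the same
number of points of corank at least two. -/
theorem ncard_degeneracyLocus_eq {A B : Fin 5 → Matrix (Fin 5) (Fin 5) ℂ} {s : Set ℂ}
    (hs : s.Finite) (h0 : (0 : ℂ) ∉ s) (h1 : (1 : ℂ) ∉ s)
    (h : ∀ t ∉ s, IsTransversal (A + t • B)) :
    (degeneracyLocus (A + B)).ncard = (degeneracyLocus A).ncard := by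
  -- Removing finitely many points does not disconnect the complex line, and a continuous function
  -- with values in ℕ is constant on a connected set.
  have hconn : IsPreconnected sᶜ :=
    (hs.countable.isConnected_compl_of_one_lt_rank (by simp)).isPreconnected
  have hcont : ContinuousOn (fun t : ℂ => (degeneracyLocus (A + t • B)).ncard) sᶜ := by
    intro t ht
    apply ContinuousAt.continuousWithinAt
    have h2 := (finite_and_eventually_ncard_degeneracyLocus_eq (h t ht) B).2
    have h3 : Tendsto (fun u : ℂ => u - t) (𝓝 t) (𝓝 0) := by
      have : Continuous (fun u : ℂ => u - t) := by fun_prop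
      simpa using this.tendsto t
    refine ContinuousAt.congr (continuousAt_const (y := (degeneracyLocus (A + t • B)).ncard)) ?_
    filter_upwards [h3.eventually h2] with u hu
    rw [← hu, add_assoc, ← add_smul]
    simp
  have := hconn.constant hcont (x := 1) (y := 0) h1 h0
  simpa using this

end Degeneracy

/-! ### Cycle matrices and the combinatorics of their cofactors -/

section CycleMatrix

open Matrix

/-- The matrix whose nonzero entries form a cycle of length ten. -/
def cycleMatrix {R : Type} [CommRing R] (f : ℕ → R) : Matrix (Fin 5) (Fin 5) R :=
  !![f 0, f 1, 0, 0, 0; 0, f 2, f 3, 0, 0; 0, 0, f 4, f 5, 0; 0, 0, 0, f 6, f 7; f 9, 0, 0, 0, f 8]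

/-- The adjugate of `cycleMatrix f`. -/
def cycleAdjugate {R : Type} [CommRing R] (f : ℕ → R) : Matrix (Fin 5) (Fin 5) R :=
  !![f 2 * f 4 * f 6 * f 8, -(f 1 * f 4 * f 6 * f 8), f 1 * f 3 * f 6 * f 8,
      -(f 1 * f 3 * f 5 * f 8), f 1 * f 3 * f 5 * f 7;
    f 3 * f 5 * f 7 * f 9, f 0 * f 4 * f 6 * f 8, -(f 0 * f 3 * f 6 * f 8), f 0 * f 3 * f 5 * f 8,
      -(f 0 * f 3 * f 5 * f 7);
    -(f 2 * f 5 * f 7 * f 9), f 1 * f 5 * f 7 * f 9, f 0 * f 2 * f 6 * f 8,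
      -(f 0 * f 2 * f 5 * f 8), f 0 * f 2 * f 5 * f 7;
    f 2 * f 4 * f 7 * f 9, -(f 1 * f 4 * f 7 * f 9), f 1 * f 3 * f 7 * f 9, f 0 * f 2 * f 4 * f 8,
      -(f 0 * f 2 * f 4 * f 7);
    -(f 2 * f 4 * f 6 * f 9), f 1 * f 4 * f 6 * f 9, -(f 1 * f 3 * f 6 * f 9),
      f 1 * f 3 * f 5 * f 9, f 0 * f 2 * f 4 * f 6]

theorem det_cycleMatrix {R : Type} [CommRing R] (f : ℕ → R) : (cycleMatrix f).det =
    f 0 * f 2 * f 4 * f 6 * f 8 + f 1 * f 3 * f 5 * f 7 * f 9 := by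
  simp [cycleMatrix, det_succ_row_zero, Fin.sum_univ_succ, Fin.succAbove]
  ring

theorem cycleMatrix_mul_cycleAdjugate {R : Type} [CommRing R] (f : ℕ → R) :
    cycleMatrix f * cycleAdjugate f = (cycleMatrix f).det • 1 := by
  rw [det_cycleMatrix]
  ext i j
  fin_cases i <;> fin_cases j <;>
    simp [cycleMatrix, cycleAdjugate, Matrix.mul_apply, Fin.sum_univ_succ] <;> ring

theorem map_cycleMatrix {R S : Type} [CommRing R] [CommRing S] (φ : R →+* S) (f : ℕ → R) :
    (cycleMatrix f).map φ = cycleMatrix (fun e => φ (f e)) := by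
  ext i j
  fin_cases i <;> fin_cases j <;> simp [cycleMatrix]

theorem map_cycleAdjugate {R S : Type} [CommRing R] [CommRing S] (φ : R →+* S) (f : ℕ → R) :
    (cycleAdjugate f).map φ = cycleAdjugate (fun e => φ (f e)) := by
  ext i j
  fin_cases i <;> fin_cases j <;> simp [cycleAdjugate]

/-- For indeterminate entries the determinant is nonzero and can be cancelled from M adj = det; the
identity then specializes to every f, including those with determinant 0. -/
theorem adjugate_cycleMatrix (f : ℕ → ℂ) : (cycleMatrix f).adjugate = cycleAdjugate f := by
  have h : (cycleMatrix (X : ℕ → MvPolynomial ℕ ℂ)).adjugate = cycleAdjugate X := by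
    set M := cycleMatrix (X : ℕ → MvPolynomial ℕ ℂ)
    have h1 : M.adjugate * (M * cycleAdjugate X) = M.det • M.adjugate := by
      rw [cycleMatrix_mul_cycleAdjugate]; simp [M]
    rw [← Matrix.mul_assoc, adjugate_mul, Matrix.smul_mul, Matrix.one_mul] at h1
    refine (smul_right_injective _ ?_ h1).symm
    intro h0
    have := congrArg (eval (fun _ => (1 : ℂ))) h0
    simp [M, det_cycleMatrix] at this
  have h2 := congrArg (fun N : Matrix (Fin 5) (Fin 5) (MvPolynomial ℕ ℂ) => N.map (eval f)) h
  simp only [map_cycleAdjugate, eval_X] at h2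
  rw [← h2, ← RingHom.mapMatrix_apply, RingHom.map_adjugate, RingHom.mapMatrix_apply,
    map_cycleMatrix]
  simp

/-- The sets of nonzero positions that contribute to the minors of corank one. -/
def edgeSets : List (List ℕ) :=
  [[2, 4, 6, 8], [1, 4, 6, 8], [1, 3, 6, 8], [1, 3, 5, 8], [1, 3, 5, 7],
   [3, 5, 7, 9], [0, 4, 6, 8], [0, 3, 6, 8], [0, 3, 5, 8], [0, 3, 5, 7],
   [2, 5, 7, 9], [1, 5, 7, 9], [0, 2, 6, 8], [0, 2, 5, 8], [0, 2, 5, 7],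
   [2, 4, 7, 9], [1, 4, 7, 9], [1, 3, 7, 9], [0, 2, 4, 8], [0, 2, 4, 7],
   [2, 4, 6, 9], [1, 4, 6, 9], [1, 3, 6, 9], [1, 3, 5, 9], [0, 2, 4, 6]]

theorem adjugate_cycleMatrix_eq_zero_iff (f : ℕ → ℂ) :
    (cycleMatrix f).adjugate = 0 ↔ ∀ s ∈ edgeSets, ∃ e ∈ s, f e = 0 := by
  rw [adjugate_cycleMatrix, ← Matrix.ext_iff]
  simp [Fin.forall_fin_succ, cycleAdjugate, edgeSets, or_assoc, and_assoc]

/-- The set of binary digits `n` meets all the edge sets. -/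
def isCover (n : ℕ) : Bool := edgeSets.all fun s => s.any fun e => n.testBit e

/-- The number of ones among the first ten binary digits. -/
def digitCount (n : ℕ) : ℕ := (List.range 10).countP fun e => n.testBit e

/-- Exhaustive check of the 1024 sets of positions. Four is also the largest number of forms in
general position vanishing at a point of ℙ^4, so only covers of size four will occur. -/
theorem le_digitCount_of_isCover {n : ℕ} (hn : n < 1024) (h : isCover n) : 4 ≤ digitCount n := by
  have key : ((List.range 1024).all fun n => !isCover n || Nat.ble 4 (digitCount n)) = true := by
    decide +kernel
  have := List.all_eq_true.1 key n (List.mem_range.2 hn)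
  simpa [h] using this

/-- The set of binary digits is a minimal cover. -/
def isMinCover (n : ℕ) : Bool := isCover n && Nat.beq (digitCount n) 4

theorem card_isMinCover : ((Finset.range 1024).filter fun n => isMinCover n).card = 50 := by
  have key : ((List.range 1024).countP fun n => isMinCover n) = 50 := by decide +kernel
  rw [List.countP_eq_length_filter] at key
  simp only [Finset.card_def, Finset.filter_val, Finset.range_val, Multiset.range,
    Multiset.filter_coe, Multiset.coe_card, Bool.decide_eq_true]
  exact key

/-- Propagation of zeros along a cyclic system of two-term equations: `p` and `q` say which
coefficients are nonzero, and `b` which coordinates are known to vanish. -/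
def forward (p b : Fin 5 → Bool) : ℕ → Fin 5 → Bool
  | 0, a => b a
  | k + 1, a => b a || (p a && forward p b k (a + 1))

/-- Propagation of zeros in the direction opposite to `forward`. -/
def backward (q b : Fin 5 → Bool) : ℕ → Fin 5 → Bool
  | 0, a => b a
  | k + 1, a => b a || (q (a - 1) && backward q b k (a - 1))

/-- Propagation of zeros in both directions. -/
def propagate (p q b : Fin 5 → Bool) (a : Fin 5) : Bool := forward p b 4 a || backward q b 4 a

/-- Coordinates that vanish because of an equation with a single term. -/
def source (p q : Fin 5 → Bool) (a : Fin 5) : Bool := (p a && !q a) || (q (a - 1) && !p (a - 1))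

/-- A nonzero coefficient passes the vanishing of one coordinate to its neighbour; four passes reach
every vertex of the five-cycle. -/
theorem propagate_sound {α β x : Fin 5 → ℂ} (h : ∀ i, α i * x i + β i * x (i + 1) = 0)
    {p q b : Fin 5 → Bool} (hp : ∀ i, p i → α i ≠ 0) (hq : ∀ i, q i → β i ≠ 0)
    (hb : ∀ i, b i → x i = 0) {a : Fin 5} (ha : propagate p q b a) : x a = 0 := by
  have hf : ∀ k a, forward p b k a → x a = 0 := by
    intro k
    induction k with
    | zero => exact fun a ha => hb a ha
    | succ k ih =>
      intro a ha
      simp only [forward, Bool.or_eq_true, Bool.and_eq_true] at ha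
      rcases ha with ha | ⟨ha, hk⟩
      · exact hb a ha
      · have := h a
        rw [ih _ hk, mul_zero, add_zero] at this
        exact (mul_eq_zero.1 this).resolve_left (hp a ha)
  have hg : ∀ k a, backward q b k a → x a = 0 := by
    intro k
    induction k with
    | zero => exact fun a ha => hb a ha
    | succ k ih =>
      intro a ha
      simp only [backward, Bool.or_eq_true, Bool.and_eq_true] at ha
      rcases ha with ha | ⟨ha, hk⟩
      · exact hb a ha
      · have := h (a - 1)
        rw [ih _ hk, mul_zero, zero_add, sub_add_cancel] at this
        exact (mul_eq_zero.1 this).resolve_left (hq _ ha)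
  rw [propagate, Bool.or_eq_true] at ha
  exact ha.elim (hf 4 a) (hg 4 a)

theorem source_sound {α β x : Fin 5 → ℂ} (h : ∀ i, α i * x i + β i * x (i + 1) = 0)
    {p q : Fin 5 → Bool} (hp : ∀ i, p i ↔ α i ≠ 0) (hq : ∀ i, q i ↔ β i ≠ 0)
    {a : Fin 5} (ha : source p q a) : x a = 0 := by
  simp only [source, Bool.or_eq_true, Bool.and_eq_true, Bool.not_eq_true', ← Bool.not_eq_true, hp,
    hq, not_not] at ha
  rcases ha with ⟨h1, h2⟩ | ⟨h1, h2⟩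
  · have := h a
    rw [h2, zero_mul, add_zero] at this
    exact (mul_eq_zero.1 this).resolve_left h1
  · have := h (a - 1)
    rw [h2, zero_mul, zero_add, sub_add_cancel] at this
    exact (mul_eq_zero.1 this).resolve_left h1

/-- The diagonal entry `i` is nonzero. -/
def diagBit (n : ℕ) (i : Fin 5) : Bool := !n.testBit (2 * i)

/-- The entry to the right of the diagonal entry `i` is nonzero. -/
def offBit (n : ℕ) (i : Fin 5) : Bool := !n.testBit (2 * i + 1)

/-- The entries of an annihilator that are forced to vanish by its being in the kernel and the
cokernel, if the entries with `b` do. -/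
def forced (n : ℕ) (b : Fin 5 → Fin 5 → Bool) (i j : Fin 5) : Bool :=
  propagate (diagBit n) (offBit n)
    (fun i => propagate (offBit n) (fun j => diagBit n (j + 1))
      (fun j => source (diagBit n) (offBit n) i ||
        source (offBit n) (fun j => diagBit n (j + 1)) j || b i j) j) i

/-- Exhaustive check. The positions (i, i) and (i + 1, i) of an annihilator are the ten that pair
with the cycle in the trace conditions. Those paired with a nonvanishing form are forced to be zero;
the others are left to the trace conditions, after which propagation kills the whole matrix. -/
theorem forced_of_isMinCover {n : ℕ} (hn : n < 1024) (h : isMinCover n) (i j : Fin 5) :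
    (diagBit n i → forced n (fun _ _ => false) i i) ∧
    (offBit n i → forced n (fun _ _ => false) (i + 1) i) ∧
    forced n (fun a b => decide (a = b) || decide (a = b + 1)) i j := by
  have key : ((List.range 1024).all fun n => !isMinCover n || (List.finRange 5).all fun i =>
      (!diagBit n i || forced n (fun _ _ => false) i i) &&
      (!offBit n i || forced n (fun _ _ => false) (i + 1) i) &&
      (List.finRange 5).all fun j =>
        forced n (fun a b => decide (a = b) || decide (a = b + 1)) i j) = true := by
    decide +kernel
  have := List.all_eq_true.1 key n (List.mem_range.2 hn)
  simp only [h, Bool.not_true, Bool.false_or] at this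
  have := List.all_eq_true.1 this i (List.mem_finRange i)
  simp only [Bool.and_eq_true] at this
  refine ⟨fun h => ?_, fun h => ?_, List.all_eq_true.1 this.2 j (List.mem_finRange j)⟩
  · simpa only [h, Bool.not_true, Bool.false_or] using this.1.1
  · simpa only [h, Bool.not_true, Bool.false_or] using this.1.2

end CycleMatrix

/-! ### The explicit system with fifty corank-two points -/

section Example

open Matrix

/-- The value at `e + 1` of the polynomial with coefficients `y`. -/
def nodeForm (y : Fin 5 → ℂ) (e : ℕ) : ℂ := ∑ k, y k * ((e : ℂ) + 1) ^ (k : ℕ)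

/-- A linear system of cycle matrices whose entries are linear forms in general position. -/
def baseSystem (k : Fin 5) : Matrix (Fin 5) (Fin 5) ℂ :=
  cycleMatrix fun e => ((e : ℂ) + 1) ^ (k : ℕ)

theorem pencil_baseSystem (y : Fin 5 → ℂ) :
    pencil baseSystem y = cycleMatrix (nodeForm y) := by
  ext i j
  rw [pencil_apply]
  fin_cases i <;> fin_cases j <;> simp [baseSystem, cycleMatrix, nodeForm]

/-- The polynomial with coefficients `y`. -/
def coeffPoly (y : Fin 5 → ℂ) : Polynomial ℂ := ∑ k, Polynomial.C (y k) * Polynomial.X ^ (k : ℕ)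

theorem eval_coeffPoly (y : Fin 5 → ℂ) (t : ℂ) :
    (coeffPoly y).eval t = ∑ k, y k * t ^ (k : ℕ) := by
  simp [coeffPoly, Polynomial.eval_finsetSum]

/-- A polynomial of degree at most 4 has at most four roots unless it is zero. This is the general
position of the forms: any five of the ten `nodeForm` are independent. -/
theorem eq_zero_of_five_roots {y : Fin 5 → ℂ} {s : Finset ℂ} (hs : 5 ≤ s.card)
    (h : ∀ t ∈ s, ∑ k, y k * t ^ (k : ℕ) = 0) : y = 0 := by
  have hdeg : (coeffPoly y).degree < 5 := by
    rw [coeffPoly]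
    refine (Polynomial.degree_sum_le _ _).trans_lt ?_
    rw [Finset.sup_lt_iff (by exact WithBot.bot_lt_coe 5)]
    intro k _
    refine (Polynomial.degree_C_mul_X_pow_le _ _).trans_lt ?_
    exact_mod_cast k.isLt
  have h0 : coeffPoly y = 0 := by
    refine Polynomial.eq_zero_of_degree_lt_of_eval_finset_eq_zero s
      (hdeg.trans_le (by exact_mod_cast hs)) fun t ht => ?_
    rw [eval_coeffPoly, h t ht]
  ext k
  have := congrArg (fun p => p.coeff (k : ℕ)) h0
  simpa [coeffPoly, Polynomial.finsetSum_coeff, Polynomial.coeff_C_mul, Polynomial.coeff_X_pow,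
    Fin.val_inj] using this

theorem exists_coeff_of_roots (s : Finset ℂ) (hs : s.card ≤ 4) :
    ∃ y : Fin 5 → ℂ, ∀ t, ∑ k, y k * t ^ (k : ℕ) = ∏ r ∈ s, (t - r) := by
  let P : Polynomial ℂ := ∏ r ∈ s, (Polynomial.X - Polynomial.C r)
  have hdeg : P.natDegree < 5 := by
    have : P.natDegree ≤ s.card := by
      rw [Polynomial.natDegree_prod_of_monic s (fun r => Polynomial.X - Polynomial.C r)
        fun r _ => Polynomial.monic_X_sub_C r]
      simp
    omega
  refine ⟨fun k => P.coeff k, fun t => ?_⟩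
  have h1 : P.eval t = ∏ r ∈ s, (t - r) := by simp [P, Polynomial.eval_prod]
  rw [← h1, Polynomial.eval_eq_sum_range' hdeg, Fin.sum_univ_eq_sum_range
    (fun k => P.coeff k * t ^ k)]

/-- The nodes with numbers given by the binary digits of `n`. -/
def nodes (n : ℕ) : Finset ℂ :=
  ((Finset.range 10).filter fun e => n.testBit e).image fun e : ℕ => (e : ℂ) + 1

theorem node_injective : Function.Injective fun e : ℕ => (e : ℂ) + 1 := fun a b h => by
  simpa using h

theorem card_nodes (n : ℕ) : (nodes n).card = digitCount n := by
  rw [nodes, Finset.card_image_of_injective _ node_injective, digitCount,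
    List.countP_eq_length_filter]
  simp only [Finset.card_def, Finset.filter_val, Finset.range_val, Multiset.range,
    Multiset.filter_coe, Multiset.coe_card, Bool.decide_eq_true]

theorem mem_nodes {n e : ℕ} (he : e < 10) : (e : ℂ) + 1 ∈ nodes n ↔ n.testBit e := by
  simp [nodes, he]

/-- The nodes start at 1 because the value at 0 is the coordinate y 0, which must not vanish at a
degenerate point. -/
theorem zero_notMem_nodes (n : ℕ) : (0 : ℂ) ∉ nodes n := by
  simp only [nodes, Finset.mem_image, not_exists, not_and]
  intro e _ h
  exact Nat.cast_add_one_ne_zero e h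

/-- The zero pattern of the linear forms at `y`. -/
def zeroPattern (y : Fin 5 → ℂ) : ℕ :=
  open Classical in Nat.ofBits fun e : Fin 10 => decide (nodeForm y e = 0)

theorem testBit_zeroPattern (y : Fin 5 → ℂ) {e : ℕ} (he : e < 10) :
    (zeroPattern y).testBit e ↔ nodeForm y e = 0 := by
  rw [zeroPattern, Nat.testBit_ofBits_lt _ _ he]
  simp

theorem zeroPattern_lt (y : Fin 5 → ℂ) : zeroPattern y < 1024 :=
  Nat.ofBits_lt_two_pow _

theorem zeroPattern_eq {y : Fin 5 → ℂ} {n : ℕ} (hn : n < 1024)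
    (h : ∀ e < 10, nodeForm y e = 0 ↔ n.testBit e) : zeroPattern y = n := by
  apply Nat.eq_of_testBit_eq
  intro e
  by_cases he : e < 10
  · rw [Bool.eq_iff_iff, testBit_zeroPattern y he, h e he]
  · rw [Nat.testBit_lt_two_pow ((zeroPattern_lt y).trans_le _),
      Nat.testBit_lt_two_pow (hn.trans_le _)] <;>
    exact (show 1024 = 2 ^ 10 by norm_num) ▸ Nat.pow_le_pow_right (by norm_num) (by omega)

theorem root_of_mem_nodes {y : Fin 5 → ℂ} {t : ℂ} (ht : t ∈ nodes (zeroPattern y)) :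
    ∑ k, y k * t ^ (k : ℕ) = 0 := by
  simp only [nodes, Finset.mem_image, Finset.mem_filter, Finset.mem_range] at ht
  obtain ⟨e, ⟨he, hb⟩, rfl⟩ := ht
  exact (testBit_zeroPattern y he).1 hb

theorem digitCount_zeroPattern_le {y : Fin 5 → ℂ} (hy : y ≠ 0) :
    digitCount (zeroPattern y) ≤ 4 := by
  by_contra! h
  rw [← card_nodes] at h
  exact hy (eq_zero_of_five_roots h fun t => root_of_mem_nodes)

/-- The vanishing forms must cover all monomials of the adjugate, which takes at least four of them,
while general position allows at most four. -/
theorem adjugate_pencil_baseSystem_eq_zero_iff {y : Fin 5 → ℂ} (hy : y ≠ 0) :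
    (pencil baseSystem y).adjugate = 0 ↔ isMinCover (zeroPattern y) := by
  rw [pencil_baseSystem, adjugate_cycleMatrix_eq_zero_iff]
  have h1 : (∀ s ∈ edgeSets, ∃ e ∈ s, nodeForm y e = 0) ↔ isCover (zeroPattern y) := by
    have hlt : ∀ s ∈ edgeSets, ∀ e ∈ s, e < 10 := by decide
    simp only [isCover, List.all_eq_true, List.any_eq_true]
    refine forall₂_congr fun s hs => exists_congr fun e => and_congr_right fun he => ?_
    rw [testBit_zeroPattern y (hlt s hs e he)]
  rw [h1, isMinCover, Bool.and_eq_true, Nat.beq_eq, iff_self_and]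
  intro h
  exact le_antisymm (digitCount_zeroPattern_le hy) (le_digitCount_of_isCover (zeroPattern_lt y) h)

theorem digitCount_of_isMinCover {n : ℕ} (h : isMinCover n) : digitCount n = 4 := by
  rw [isMinCover, Bool.and_eq_true] at h
  exact Nat.eq_of_beq_eq_true h.2

theorem eq_zero_of_zeroPattern {y z : Fin 5 → ℂ} (h : digitCount (zeroPattern z) = 4)
    (hyz : ∀ t ∈ nodes (zeroPattern z), ∑ k, y k * t ^ (k : ℕ) = 0) (hy : y 0 = 0) : y = 0 := by
  refine eq_zero_of_five_roots (s := insert 0 (nodes (zeroPattern z))) ?_ ?_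
  · rw [Finset.card_insert_of_notMem (zero_notMem_nodes _), card_nodes, h]
  · intro t ht
    rcases Finset.mem_insert.1 ht with rfl | ht
    · simp [Fin.sum_univ_succ, hy]
    · exact hyz t ht

/-- A minimal cover prescribes four roots, hence a polynomial of degree 4 up to scaling, and its
nonzero constant term is normalized to 1. It has no further roots, so the cover is recovered as its
zero pattern. -/
theorem ncard_degeneracyLocus_baseSystem : (degeneracyLocus baseSystem).ncard = 50 := by
  rw [← card_isMinCover, ← Set.ncard_coe_finset]
  have hmem : ∀ v, v ∈ degeneracyLocus baseSystem ↔ isMinCover (zeroPattern (Fin.cons 1 v)) :=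
    fun v => adjugate_pencil_baseSystem_eq_zero_iff (cons_one_ne_zero v)
  refine Set.ncard_congr (fun v _ => zeroPattern (Fin.cons 1 v)) ?_ ?_ ?_
  · intro v hv
    have := (hmem v).1 hv
    simp [zeroPattern_lt, this]
  · intro v w hv hw hvw
    change zeroPattern _ = zeroPattern _ at hvw
    have hc := digitCount_of_isMinCover ((hmem v).1 hv)
    have h0 := eq_zero_of_zeroPattern (y := (Fin.cons 1 v : Fin 5 → ℂ) - Fin.cons 1 w) hc
      (fun t ht => by
        have h1 := root_of_mem_nodes ht
        rw [hvw] at ht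
        have h2 := root_of_mem_nodes ht
        simp only [Pi.sub_apply, sub_mul, Finset.sum_sub_distrib, h1, h2, sub_zero]) (by simp)
    ext i
    have := congrFun h0 i.succ
    simpa [sub_eq_zero] using this
  · intro n hn
    simp only [Finset.coe_filter, Finset.mem_range, Set.mem_ofPred_eq] at hn
    obtain ⟨hn, hcov⟩ := hn
    obtain ⟨y, hy⟩ := exists_coeff_of_roots (nodes n)
      (by rw [card_nodes, digitCount_of_isMinCover hcov])
    have hy0 : y 0 ≠ 0 := by
      have h1 := hy 0
      have h2 : ∑ k, y k * (0 : ℂ) ^ (k : ℕ) = y 0 := by simp [Fin.sum_univ_succ]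
      rw [h2] at h1
      rw [h1, Finset.prod_ne_zero_iff]
      intro r hr h
      have : r = 0 := by simpa using h
      exact zero_notMem_nodes n (this ▸ hr)
    have hcons : (Fin.cons 1 (fun i => (y 0)⁻¹ * y i.succ) : Fin 5 → ℂ) = (y 0)⁻¹ • y := by
      ext i
      refine Fin.cases ?_ (fun i => ?_) i
      · simp [hy0]
      · simp
    have hpat : zeroPattern (Fin.cons 1 (fun i => (y 0)⁻¹ * y i.succ)) = n := by
      apply zeroPattern_eq hn
      intro e he
      rw [hcons]
      have h1 : nodeForm ((y 0)⁻¹ • y) e = (y 0)⁻¹ * ∏ r ∈ nodes n, ((e : ℂ) + 1 - r) := by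
        rw [← hy, Finset.mul_sum]
        simp [nodeForm, mul_assoc]
      rw [h1, mul_eq_zero, or_iff_right (inv_ne_zero hy0), Finset.prod_eq_zero_iff,
        ← mem_nodes he]
      constructor
      · rintro ⟨r, hr, h⟩
        rwa [sub_eq_zero.1 h]
      · exact fun h => ⟨_, h, sub_self _⟩
    exact ⟨_, (hmem _).2 (by rw [hpat]; exact hcov), hpat⟩

theorem cycleMatrix_mul_apply (f : ℕ → ℂ) (N : Matrix (Fin 5) (Fin 5) ℂ) (i j : Fin 5) :
    (cycleMatrix f * N) i j = f (2 * i) * N i j + f (2 * i + 1) * N (i + 1) j := by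
  rw [Matrix.mul_apply]
  fin_cases i <;> simp [cycleMatrix, Fin.sum_univ_succ] <;>
    first | rfl | exact add_comm _ _

theorem mul_cycleMatrix_apply (f : ℕ → ℂ) (N : Matrix (Fin 5) (Fin 5) ℂ) (i j : Fin 5) :
    (N * cycleMatrix f) i (j + 1) =
      f (2 * j + 1) * N i j + f (2 * (j + 1 : Fin 5)) * N i (j + 1) := by
  rw [Matrix.mul_apply]
  fin_cases j <;> simp [cycleMatrix, Fin.sum_univ_succ] <;> ring

theorem trace_mul_cycleMatrix (f : ℕ → ℂ) (N : Matrix (Fin 5) (Fin 5) ℂ) :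
    (N * cycleMatrix f).trace = ∑ i : Fin 5, (f (2 * i) * N i i + f (2 * i + 1) * N (i + 1) i) := by
  rw [Matrix.trace_mul_comm, Matrix.trace]
  exact Finset.sum_congr rfl fun i _ => cycleMatrix_mul_apply f N i i

theorem diagBit_zeroPattern (y : Fin 5 → ℂ) (i : Fin 5) :
    diagBit (zeroPattern y) i ↔ nodeForm y (2 * i) ≠ 0 := by
  rw [diagBit, Bool.not_eq_true', ← Bool.not_eq_true, testBit_zeroPattern y (by omega)]

theorem offBit_zeroPattern (y : Fin 5 → ℂ) (i : Fin 5) :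
    offBit (zeroPattern y) i ↔ nodeForm y (2 * i + 1) ≠ 0 := by
  rw [offBit, Bool.not_eq_true', ← Bool.not_eq_true, testBit_zeroPattern y (by omega)]

/-- MN = 0 relates cyclic neighbours within a column of N, and NM = 0 within a row; the inner
propagation runs along rows, the outer one along columns. -/
theorem forced_sound {y : Fin 5 → ℂ} {N : Matrix (Fin 5) (Fin 5) ℂ}
    (h1 : cycleMatrix (nodeForm y) * N = 0) (h2 : N * cycleMatrix (nodeForm y) = 0)
    {b : Fin 5 → Fin 5 → Bool} (hb : ∀ i j, b i j → N i j = 0) {i j : Fin 5}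
    (h : forced (zeroPattern y) b i j) : N i j = 0 := by
  have hcol : ∀ j i : Fin 5, nodeForm y (2 * i) * N i j + nodeForm y (2 * i + 1) * N (i + 1) j = 0 := by
    intro j i
    rw [← cycleMatrix_mul_apply, h1]; rfl
  have hrow : ∀ i j : Fin 5, nodeForm y (2 * j + 1) * N i j +
      nodeForm y (2 * (j + 1 : Fin 5)) * N i (j + 1) = 0 := by
    intro i j
    rw [← mul_cycleMatrix_apply, h2]; rfl
  have hd := diagBit_zeroPattern y
  have ho := offBit_zeroPattern y
  refine propagate_sound (hcol j) (fun i => (hd i).1) (fun i => (ho i).1) (fun i hi => ?_) h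
  refine propagate_sound (hrow i) (fun j => (ho j).1) (fun j => (hd (j + 1)).1) (fun j hj => ?_) hi
  simp only [Bool.or_eq_true] at hj
  rcases hj with (hj | hj) | hj
  · exact source_sound (hcol j) hd ho hj
  · exact source_sound (hrow i) ho (fun j => hd (j + 1)) hj
  · exact hb i j hj

theorem isTransversal_baseSystem : IsTransversal baseSystem := by
  intro y hy hadj
  have hcov := (adjugate_pencil_baseSystem_eq_zero_iff hy).1 hadj
  have hc := digitCount_of_isMinCover hcov
  refine ⟨fun h0 => hy (eq_zero_of_zeroPattern hc (fun t => root_of_mem_nodes) h0), ?_⟩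
  rintro N ⟨h1, h2, h3⟩
  rw [pencil_baseSystem] at h1 h2
  have hforced := forced_of_isMinCover (zeroPattern_lt y) hcov
  have hrel : ∀ v, ∑ i : Fin 5, (nodeForm v (2 * i) * N i i +
      nodeForm v (2 * i + 1) * N (i + 1) i) = 0 := by
    intro v
    rw [← trace_mul_cycleMatrix, ← pencil_baseSystem, pencil, Matrix.mul_sum, Matrix.trace_sum]
    refine Finset.sum_eq_zero fun k _ => ?_
    rw [Matrix.mul_smul, Matrix.trace_smul, h3, smul_zero]
  have hdiag0 : ∀ i : Fin 5, nodeForm y (2 * i) ≠ 0 → N i i = 0 := fun i hi =>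
    forced_sound h1 h2 (by simp) ((hforced i i).1 ((diagBit_zeroPattern y i).2 hi))
  have hoff0 : ∀ i : Fin 5, nodeForm y (2 * i + 1) ≠ 0 → N (i + 1) i = 0 := fun i hi =>
    forced_sound h1 h2 (by simp) ((hforced i i).2.1 ((offBit_zeroPattern y i).2 hi))
  -- The polynomial with the other three roots isolates one of the four vanishing forms. Evaluating
  -- the trace relation there leaves a single entry of `N`.
  have hsep : ∀ e < 10, nodeForm y e = 0 → ∃ v, nodeForm v e ≠ 0 ∧
      ∀ e' < 10, e' ≠ e → nodeForm y e' = 0 → nodeForm v e' = 0 := by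
    intro e he hye
    obtain ⟨v, hv⟩ := exists_coeff_of_roots ((nodes (zeroPattern y)).erase ((e : ℂ) + 1))
      ((Finset.card_erase_le).trans (by rw [card_nodes, hc]))
    refine ⟨v, ?_, fun e' he' hne hz => ?_⟩
    · rw [nodeForm, hv, Finset.prod_ne_zero_iff]
      intro r hr h
      exact (Finset.mem_erase.1 hr).1 (sub_eq_zero.1 h).symm
    · rw [nodeForm, hv]
      refine Finset.prod_eq_zero (i := (e' : ℂ) + 1) (Finset.mem_erase.2 ⟨?_, ?_⟩) (sub_self _)
      · exact fun h => hne (node_injective h)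
      · exact (mem_nodes he').2 ((testBit_zeroPattern y he').2 hz)
  have hdiag : ∀ i, N i i = 0 := by
    intro i
    by_contra hN
    have hz : nodeForm y (2 * i) = 0 := by
      by_contra hz
      exact hN (hdiag0 i hz)
    obtain ⟨v, hv, hv'⟩ := hsep (2 * i) (by omega) hz
    have h4 := hrel v
    have h5 : ∀ j : Fin 5, nodeForm v (2 * j + 1) * N (j + 1) j = 0 := by
      intro j
      by_cases hj : nodeForm y (2 * j + 1) = 0
      · rw [hv' _ (by omega) (by omega) hj, zero_mul]
      · rw [hoff0 j hj, mul_zero]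
    rw [Finset.sum_eq_single i] at h4
    · rw [h5, add_zero] at h4
      exact (mul_ne_zero hv hN) h4
    · intro j _ hj
      rw [h5, add_zero]
      by_cases hz : nodeForm y (2 * j) = 0
      · rw [hv' _ (by omega) (fun h => hj (Fin.ext (by omega))) hz, zero_mul]
      · rw [hdiag0 j hz, mul_zero]
    · simp
  have hoff : ∀ i, N (i + 1) i = 0 := by
    intro i
    by_contra hN
    have hz : nodeForm y (2 * i + 1) = 0 := by
      by_contra hz
      exact hN (hoff0 i hz)
    obtain ⟨v, hv, hv'⟩ := hsep (2 * i + 1) (by omega) hz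
    have h4 := hrel v
    simp only [hdiag, mul_zero, zero_add] at h4
    rw [Finset.sum_eq_single i] at h4
    · exact (mul_ne_zero hv hN) h4
    · intro j _ hj
      by_cases hz : nodeForm y (2 * j + 1) = 0
      · rw [hv' _ (by omega) (fun h => hj (Fin.ext (by omega))) hz, zero_mul]
      · rw [hoff0 j hz, mul_zero]
    · simp
  ext i j
  refine forced_sound h1 h2 (fun a b hab => ?_) (hforced i j).2.2
  simp only [Bool.or_eq_true, decide_eq_true_eq] at hab
  rcases hab with rfl | rfl
  · exact hdiag _
  · exact hoff _

end Example

/-! ### Differentials of polynomials along curves -/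

section Differentials

theorem hasDerivAt_eval {ι : Type} [Fintype ι] (f : MvPolynomial ι ℂ) {γ : ℂ → ι → ℂ} {γ' : ι → ℂ}
    {t : ℂ} (h : ∀ i, HasDerivAt (fun s => γ s i) (γ' i) t) :
    HasDerivAt (fun s => eval (γ s) f) (differential f (γ t) γ') t := by
  classical
  have hd : ∀ f : MvPolynomial ι ℂ, differential f (γ t) γ' =
      ∑ i, eval (γ t) (pderiv i f) * γ' i := fun f => by simp [differential]
  rw [hd]
  induction f using MvPolynomial.induction_on with
  | C a => simpa using hasDerivAt_const t a
  | add p q hp hq =>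
    simp only [map_add, add_mul, Finset.sum_add_distrib]
    exact hp.add hq
  | mul_X p j hp =>
    simp only [map_mul, eval_X]
    refine HasDerivAt.congr_deriv
      (show HasDerivAt (fun s => eval (γ s) p * γ s j) _ t from hp.mul (h j)) ?_
    symm
    simp only [Derivation.leibniz, pderiv_X, smul_eq_mul, map_add, map_mul, eval_X, add_mul,
      Finset.sum_add_distrib, Finset.sum_mul]
    rw [add_comm]
    congr 1
    · exact Finset.sum_congr rfl fun i _ => by ring
    · rw [Finset.sum_eq_single j (by intro i _ hi; simp [hi.symm]) (by simp)]
      simp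

theorem subset_zariskiClosure {ι : Type} (X : Set (ℙ ℂ (ι → ℂ))) : X ⊆ zariskiClosure X := by
  intro p hp f hf
  have := hf p.rep ⟨p.rep_nonzero, by rwa [p.mk_rep]⟩
  simpa using this

end Differentials

/-! ### Tangent spaces and dual variety of the Segre variety -/

section Segre

open Matrix

/-- The pure tensor of two vectors. -/
def tensor (z w : Fin 5 → ℂ) : Fin 5 × Fin 5 → ℂ := fun ij => z ij.1 * w ij.2

theorem mem_cone_segre {v : Fin 5 × Fin 5 → ℂ} :
    v ∈ cone (Set.range segre) ↔ ∃ z w, z ≠ 0 ∧ w ≠ 0 ∧ v = tensor z w := by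
  constructor
  · rintro ⟨hv, ⟨⟨p, q⟩, hpq⟩⟩
    rw [segre, Projectivization.mk_eq_mk_iff'] at hpq
    obtain ⟨a, ha⟩ := hpq
    have ha0 : a ≠ 0 := by
      rintro rfl
      rw [zero_smul] at ha
      exact segre_ne_zero p.rep_nonzero q.rep_nonzero ha.symm
    refine ⟨a⁻¹ • p.rep, q.rep, smul_ne_zero (inv_ne_zero ha0) p.rep_nonzero, q.rep_nonzero, ?_⟩
    have h1 : v = a⁻¹ • (a • v) := by rw [smul_smul, inv_mul_cancel₀ ha0, one_smul]
    rw [h1, ha]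
    ext ij
    simp [tensor, mul_assoc]
  · rintro ⟨z, w, hz, hw, rfl⟩
    refine ⟨segre_ne_zero hz hw, ⟨(Projectivization.mk ℂ z hz, Projectivization.mk ℂ w hw), ?_⟩⟩
    obtain ⟨a, ha⟩ := Projectivization.exists_smul_eq_mk_rep ℂ z hz
    obtain ⟨b, hb⟩ := Projectivization.exists_smul_eq_mk_rep ℂ w hw
    refine (Projectivization.mk_eq_mk_iff' ℂ _ _ _ _).2 ⟨(a : ℂ) * b, ?_⟩
    ext ij
    simp only [← ha, ← hb, tensor, Pi.smul_apply, smul_eq_mul, Units.smul_def]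
    ring

/-- The differential of the map `(z, w) ↦ z ⊗ w`. -/
def segreDifferential (z w : Fin 5 → ℂ) :
    ((Fin 5 → ℂ) × (Fin 5 → ℂ)) →ₗ[ℂ] (Fin 5 × Fin 5 → ℂ) where
  toFun ab := tensor ab.1 w + tensor z ab.2
  map_add' x y := by ext; simp [tensor]; ring
  map_smul' c x := by ext; simp [tensor]; ring

theorem finrank_range_segreDifferential {z w : Fin 5 → ℂ} (hz : z ≠ 0) (hw : w ≠ 0) :
    Module.finrank ℂ (LinearMap.range (segreDifferential z w)) = 9 := by
  have hker : LinearMap.ker (segreDifferential z w) = Submodule.span ℂ {(z, -w)} := by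
    ext ⟨a, b⟩
    rw [LinearMap.mem_ker, Submodule.mem_span_singleton]
    constructor
    · intro h
      have hij : ∀ i j, a i * w j + z i * b j = 0 := fun i j => congrFun h (i, j)
      obtain ⟨k, hk⟩ := Function.ne_iff.1 hz
      obtain ⟨l, hl⟩ := Function.ne_iff.1 hw
      simp only [Pi.zero_apply] at hk hl
      refine ⟨a k / z k, ?_⟩
      have hb : ∀ j, b j = -(a k / z k) * w j := by
        intro j
        field_simp
        linear_combination hij k j
      ext i
      · simp only [Prod.smul_mk, Pi.smul_apply, smul_eq_mul]
        have h1 := hij i l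
        rw [hb] at h1
        have h2 : w l * (a k / z k * z i - a i) = 0 := by linear_combination -h1
        exact sub_eq_zero.1 ((mul_eq_zero.1 h2).resolve_left hl)
      · simp [hb]
    · rintro ⟨c, hc⟩
      rw [← hc]
      ext ij
      simp [segreDifferential, tensor]
      ring
  have h1 := LinearMap.finrank_range_add_finrank_ker (segreDifferential z w)
  rw [hker, finrank_span_singleton (by simp [hz])] at h1
  simp at h1
  omega

/-- The 2 × 2 minors bound the tangent space from above; the curves (z + ta) ⊗ (w + tb) in the cone
bound it from below. The full ideal of the Segre variety is not needed. -/
theorem tangentSpace_segre {p : ℙ ℂ (Fin 5 × Fin 5 → ℂ)} {z w : Fin 5 → ℂ} (hz : z ≠ 0)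
    (hw : w ≠ 0) (hp : p.rep = tensor z w) :
    tangentSpace (Set.range segre) p = LinearMap.range (segreDifferential z w) := by
  apply le_antisymm
  · intro v hv
    simp only [tangentSpace, Submodule.mem_iInf, LinearMap.mem_ker] at hv
    have hminor : ∀ i j k l, z k * w l * v (i, j) + z i * w j * v (k, l) -
        (z k * w j * v (i, l) + z i * w l * v (k, j)) = 0 := by
      intro i j k l
      have := hv (X (i, j) * X (k, l) - X (i, l) * X (k, j)) (by
        intro x hx
        obtain ⟨z, w, -, -, rfl⟩ := mem_cone_segre.1 hx
        simp [tensor]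
        ring)
      have h2 := (hasDerivAt_eval (X (i, j) * X (k, l) - X (i, l) * X (k, j))
        (γ := fun t => p.rep + t • v) (γ' := v) (t := 0) (by
          intro i
          have := ((hasDerivAt_id' (0 : ℂ)).mul_const (v i)).const_add (p.rep i)
          simpa using this))
      simp only [zero_smul, add_zero, this, map_sub, map_mul, eval_X, Pi.add_apply,
        Pi.smul_apply, smul_eq_mul] at h2
      have lin : ∀ ij, HasDerivAt (fun t : ℂ => p.rep ij + t * v ij) (v ij) 0 := by
        intro ij
        have := ((hasDerivAt_id' (0 : ℂ)).mul_const (v ij)).const_add (p.rep ij)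
        simpa using this
      have h3 := ((lin (i, j)).mul (lin (k, l))).sub ((lin (i, l)).mul (lin (k, j)))
      have h4 := h3.unique h2
      simp only [hp, tensor, zero_mul, add_zero] at h4
      linear_combination h4
    obtain ⟨k, hk⟩ := Function.ne_iff.1 hz
    obtain ⟨l, hl⟩ := Function.ne_iff.1 hw
    simp only [Pi.zero_apply] at hk hl
    -- A preimage is read off from column l and row k, where w l and z k do not vanish; the
    -- linearized minors give the other entries.
    refine ⟨(fun i => v (i, l) / w l, fun j => (v (k, j) - w j * v (k, l) / w l) / z k), ?_⟩
    ext ⟨i, j⟩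
    have := hminor i j k l
    simp only [segreDifferential, LinearMap.coe_mk, AddHom.coe_mk, tensor, Pi.add_apply]
    field_simp
    linear_combination -this
  · rintro _ ⟨⟨a, b⟩, rfl⟩
    simp only [tangentSpace, Submodule.mem_iInf, LinearMap.mem_ker]
    intro f hf
    have h1 := hasDerivAt_eval f (γ := fun t => tensor (z + t • a) (w + t • b))
      (γ' := segreDifferential z w (a, b)) (t := 0) (by
        rintro ⟨i, j⟩
        have hz' : HasDerivAt (fun t : ℂ => z i + t * a i) (a i) 0 := by
          simpa using ((hasDerivAt_id' (0 : ℂ)).mul_const (a i)).const_add (z i)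
        have hw' : HasDerivAt (fun t : ℂ => w j + t * b j) (b j) 0 := by
          simpa using ((hasDerivAt_id' (0 : ℂ)).mul_const (b j)).const_add (w j)
        have : HasDerivAt (fun t : ℂ => (z i + t * a i) * (w j + t * b j)) _ 0 := hz'.mul hw'
        simpa [tensor, segreDifferential] using this)
    simp only [zero_smul, add_zero, ← hp] at h1
    have h2 : ∀ᶠ t in 𝓝 (0 : ℂ), eval (tensor (z + t • a) (w + t • b)) f = 0 := by
      have c1 : ContinuousAt (fun t : ℂ => z + t • a) 0 := by fun_prop
      have c2 : ContinuousAt (fun t : ℂ => w + t • b) 0 := by fun_prop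
      filter_upwards [c1.eventually_ne (y := 0) (by simpa using hz),
        c2.eventually_ne (y := 0) (by simpa using hw)] with t h1 h2
      have := hf _ (mem_cone_segre.2 ⟨_, _, h1, h2, rfl⟩)
      simpa using this
    have h3 : HasDerivAt (fun t : ℂ => eval (tensor (z + t • a) (w + t • b)) f) 0 0 :=
      (hasDerivAt_const (0 : ℂ) (0 : ℂ)).congr_of_eventuallyEq h2
    exact h1.unique h3

theorem exists_rep_eq_tensor {p : ℙ ℂ (Fin 5 × Fin 5 → ℂ)} (hp : p ∈ Set.range segre) :
    ∃ z w, z ≠ 0 ∧ w ≠ 0 ∧ p.rep = tensor z w :=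
  mem_cone_segre.1 ⟨p.rep_nonzero, by rwa [p.mk_rep]⟩

theorem smoothLocus_segre : smoothLocus (Set.range segre) = Set.range segre := by
  ext p
  refine ⟨fun h => h.1, fun hp => ⟨hp, fun q hq => ?_⟩⟩
  obtain ⟨z, w, hz, hw, h⟩ := exists_rep_eq_tensor hp
  obtain ⟨z', w', hz', hw', h'⟩ := exists_rep_eq_tensor hq
  rw [tangentSpace_segre hz hw h, tangentSpace_segre hz' hw' h',
    finrank_range_segreDifferential hz hw, finrank_range_segreDifferential hz' hw']

/-- The square matrix with the given entries. -/
def toMatrix (c : Fin 5 × Fin 5 → ℂ) : Matrix (Fin 5) (Fin 5) ℂ := Matrix.of fun i j => c (i, j)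

theorem dotProduct_segreDifferential (c : Fin 5 × Fin 5 → ℂ) (z w a b : Fin 5 → ℂ) :
    c ⬝ᵥ segreDifferential z w (a, b) = a ⬝ᵥ (toMatrix c *ᵥ w) + (z ᵥ* toMatrix c) ⬝ᵥ b := by
  rw [← dotProduct_mulVec]
  simp only [segreDifferential, LinearMap.coe_mk, AddHom.coe_mk, dotProduct_add]
  simp only [dotProduct, mulVec, tensor, toMatrix, Matrix.of_apply, Fintype.sum_prod_type,
    Finset.mul_sum]
  congr 1 <;>
  exact Finset.sum_congr rfl fun i _ => Finset.sum_congr rfl fun j _ => by ring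

/-- A hyperplane is tangent to the Segre variety if and only if its matrix is singular. -/
theorem setOf_tangent_eq :
    {c : ℙ ℂ (Fin 5 × Fin 5 → ℂ) | ∃ p ∈ smoothLocus (Set.range segre),
      ∀ v ∈ tangentSpace (Set.range segre) p, c.rep ⬝ᵥ v = 0} =
    {c | (toMatrix c.rep).det = 0} := by
  ext c
  rw [smoothLocus_segre]
  constructor
  · rintro ⟨p, hp, h⟩
    obtain ⟨z, w, hz, hw, hpr⟩ := exists_rep_eq_tensor hp
    rw [tangentSpace_segre hz hw hpr] at h
    refine exists_mulVec_eq_zero_iff.1 ⟨w, hw, ?_⟩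
    ext i
    have := h _ ⟨(Pi.single i 1, 0), rfl⟩
    rw [dotProduct_segreDifferential] at this
    simpa using this
  · intro h
    obtain ⟨w, hw, hw0⟩ := exists_mulVec_eq_zero_iff.2 h
    obtain ⟨z, hz, hz0⟩ := exists_vecMul_eq_zero_iff.2 h
    have hmem : tensor z w ∈ cone (Set.range segre) := mem_cone_segre.2 ⟨z, w, hz, hw, rfl⟩
    obtain ⟨hne, hp⟩ := hmem
    obtain ⟨a, ha⟩ := Projectivization.exists_smul_eq_mk_rep ℂ _ hne
    refine ⟨_, hp, ?_⟩
    rw [tangentSpace_segre (z := (a : ℂ) • z) (w := w) (smul_ne_zero a.ne_zero hz) hw (by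
      rw [← ha]
      ext ij
      simp [tensor, Units.smul_def, mul_assoc])]
    rintro _ ⟨⟨x, y⟩, rfl⟩
    rw [dotProduct_segreDifferential, hw0, smul_vecMul, hz0]
    simp

/-- The set of tangent hyperplanes is already closed, being cut out by the determinant. -/
theorem dualVariety_segre :
    dualVariety (Set.range segre) = {c | (toMatrix c.rep).det = 0} := by
  rw [dualVariety, setOf_tangent_eq]
  refine Set.Subset.antisymm (fun c hc => ?_) (subset_zariskiClosure _)
  let f : MvPolynomial (Fin 5 × Fin 5) ℂ := Matrix.det (Matrix.of fun i j => X (i, j))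
  have heval : ∀ v, eval v f = (toMatrix v).det := by
    intro v
    rw [RingHom.map_det]
    congr 1
    ext i j
    simp [toMatrix]
  rw [Set.mem_ofPred_eq, ← heval]
  refine hc f ?_
  rintro v ⟨hv, h⟩
  obtain ⟨a, ha⟩ := Projectivization.exists_smul_eq_mk_rep ℂ v hv
  have h1 : toMatrix (Projectivization.mk ℂ v hv).rep = (a : ℂ) • toMatrix v := by
    rw [← ha]; rfl
  rw [Set.mem_ofPred_eq, h1, det_smul] at h
  rw [aeval_eq_eval, heval]
  exact (mul_eq_zero.1 h).resolve_left (pow_ne_zero _ a.ne_zero)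

theorem toMatrix_spanMap (A : Fin 5 → Matrix (Fin 5) (Fin 5) ℂ) (y : Fin 5 → ℂ) :
    toMatrix (spanMap A y) = pencil A y := by
  ext i j
  simp [toMatrix, spanMap, Fintype.linearCombination_apply, dualPoint, pencil_apply]

theorem mukaiDual_segre (A : Fin 5 → Matrix (Fin 5) (Fin 5) ℂ)
    (hA : Function.Injective (spanMap A)) :
    mukaiDual (Set.range segre) (dualPoint A) =
      Projectivization.map (spanMap A) hA ''
        {y : ℙ ℂ (Fin 5 → ℂ) | Matrix.det (∑ k, y.rep k • A k) = 0} := by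
  have hrep : ∀ (y : ℙ ℂ (Fin 5 → ℂ)),
      ∃ a : ℂ, a ≠ 0 ∧ (Projectivization.map (spanMap A) hA y).rep = a • spanMap A y.rep := by
    intro y
    have hne : spanMap A y.rep ≠ 0 := fun h => y.rep_nonzero (hA (by rw [h, map_zero]))
    have h1 : Projectivization.map (spanMap A) hA y = Projectivization.mk ℂ _ hne := by
      conv_lhs => rw [← y.mk_rep]
      rfl
    obtain ⟨a, ha⟩ := Projectivization.exists_smul_eq_mk_rep ℂ _ hne
    exact ⟨a, a.ne_zero, by rw [h1, ← ha]; rfl⟩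
  have hspan : Submodule.span ℂ (Set.range (dualPoint A)) = LinearMap.range (spanMap A) :=
    (Fintype.range_linearCombination ℂ _).symm
  have hsmul : ∀ (a : ℂ) (c : Fin 5 × Fin 5 → ℂ), toMatrix (a • c) = a • toMatrix c :=
    fun _ _ => rfl
  have hdet : ∀ y : ℙ ℂ (Fin 5 → ℂ), (toMatrix (Projectivization.map (spanMap A) hA y).rep).det = 0
      ↔ (∑ k, y.rep k • A k).det = 0 := by
    intro y
    obtain ⟨a, ha, h⟩ := hrep y
    rw [h, hsmul, toMatrix_spanMap, det_smul, mul_eq_zero, or_iff_right (pow_ne_zero _ ha)]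
    rfl
  rw [mukaiDual, dualVariety_segre, hspan]
  ext c
  constructor
  · rintro ⟨h1, ⟨y, hy⟩⟩
    have hy0 : y ≠ 0 := by
      rintro rfl
      rw [map_zero] at hy
      exact c.rep_nonzero hy.symm
    have hc : Projectivization.map (spanMap A) hA (Projectivization.mk ℂ y hy0) = c := by
      rw [Projectivization.map_mk]
      conv_rhs => rw [← c.mk_rep]
      rw [Projectivization.mk_eq_mk_iff']
      exact ⟨1, by rw [one_smul, hy]⟩
    refine ⟨_, ?_, hc⟩
    rw [Set.mem_ofPred_eq, ← hdet, hc]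
    exact h1
  · rintro ⟨y, hy, rfl⟩
    refine ⟨(hdet y).2 hy, ?_⟩
    obtain ⟨a, -, h⟩ := hrep y
    exact ⟨a • y.rep, by rw [map_smul, h]⟩

end Segre

/-! ### Jacobi's formula and the singular points of the determinant -/

section Determinant

open Matrix

/-- Jacobi's formula. -/
theorem hasDerivAt_det {n : Type} [Fintype n] [DecidableEq n] (M B : Matrix n n ℂ) :
    HasDerivAt (fun t : ℂ => (M + t • B).det) (M.adjugate * B).trace 0 := by
  let D : ContinuousMultilinearMap ℂ (fun _ : n => n → ℂ) ℂ :=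
    ⟨(detRowAlternating (n := n) (R := ℂ)).toMultilinearMap, by
      change Continuous fun M : Matrix n n ℂ => M.det
      fun_prop⟩
  let γ : ℂ → n → n → ℂ := fun t i j => M i j + t * B i j
  have hγ : HasDerivAt γ (fun i j => B i j) 0 := by
    refine hasDerivAt_pi.2 fun i => hasDerivAt_pi.2 fun j => ?_
    simpa [γ] using (hasDerivAt_id (0 : ℂ)).mul_const (B i j)
  have h := (D.hasFDerivAt (γ 0)).comp_hasDerivAt (0 : ℂ) hγ
  refine HasDerivAt.congr_deriv h ?_
  rw [ContinuousMultilinearMap.linearDeriv_apply, Matrix.trace_mul_comm, Matrix.trace]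
  refine Finset.sum_congr rfl fun i _ => ?_
  have h1 : γ 0 = M := by ext i j; simp [γ]
  rw [h1]
  change (M.updateRow i (B i)).det = _
  rw [← cramer_transpose_apply, cramer_eq_adjugate_mulVec, ← adjugate_transpose]
  simp [mulVec, dotProduct, Matrix.mul_apply, mul_comm]

variable (A : Fin 5 → Matrix (Fin 5) (Fin 5) ℂ)

theorem eval_detPoly (v : Fin 5 → ℂ) : eval v (detPoly A) = (pencil A v).det := by
  rw [detPoly, RingHom.map_det]
  congr 1
  ext i j
  simp [pencil, Matrix.sum_apply]

theorem isHomogeneous_detPoly : (detPoly A).IsHomogeneous 5 := by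
  rw [detPoly, det_apply]
  refine IsHomogeneous.sum _ _ _ fun σ _ => ?_
  have h : (∏ i, (∑ k, (X k : MvPolynomial (Fin 5) ℂ) •
      (A k).map (C (σ := Fin 5))) (σ i) i).IsHomogeneous 5 := by
    have := IsHomogeneous.prod Finset.univ
      (fun i => (∑ k, (X k : MvPolynomial (Fin 5) ℂ) • (A k).map (C (σ := Fin 5))) (σ i) i) (fun _ => 1)
      fun i _ => by
        rw [Matrix.sum_apply]
        refine IsHomogeneous.sum _ _ _ fun k _ => ?_
        simpa using (isHomogeneous_X ℂ k).mul (isHomogeneous_C (Fin 5) (A k (σ i) i))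
    simpa using this
  rcases Int.units_eq_one_or (Equiv.Perm.sign σ) with hs | hs <;> rw [hs]
  · simpa using h
  · simpa using h.neg

theorem differential_detPoly (y v : Fin 5 → ℂ) :
    differential (detPoly A) y v = ((pencil A y).adjugate * pencil A v).trace := by
  have h1 := hasDerivAt_eval (detPoly A) (γ := fun t => y + t • v) (γ' := v) (t := 0) fun i => by
    simpa using ((hasDerivAt_id (0 : ℂ)).mul_const (v i)).const_add (y i)
  have h2 := hasDerivAt_det (pencil A y) (pencil A v)
  simp only [eval_detPoly, pencil_add, pencil_smul, zero_smul, add_zero] at h1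
  exact h1.unique h2

theorem det_eq_zero_of_adjugate_eq_zero {M : Matrix (Fin 5) (Fin 5) ℂ} (h : M.adjugate = 0) :
    M.det = 0 := by
  have := congrFun (congrFun (mul_adjugate M) 0) 0
  simpa [h] using this.symm

variable {A}

/-- The singular points of the quintic are the points of corank at least two. -/
theorem adjugate_eq_zero_of_differential_eq_zero {y : Fin 5 → ℂ}
    (hN : ∀ N, Annihilates A y N → N = 0) (h : (pencil A y).det = 0)
    (hd : differential (detPoly A) y = 0) : (pencil A y).adjugate = 0 := by
  -- The adjugate itself annihilates: its products with M are det M = 0, and its traces against `A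
  -- k` are the partial derivatives.
  refine hN _ ⟨by rw [mul_adjugate, h, zero_smul], by rw [adjugate_mul, h, zero_smul], fun k => ?_⟩
  have := LinearMap.congr_fun hd (Pi.single k 1)
  rw [differential_detPoly] at this
  simpa [pencil, Pi.single_apply] using this

theorem differential_eq_zero_of_adjugate_eq_zero {y : Fin 5 → ℂ}
    (h : (pencil A y).adjugate = 0) : differential (detPoly A) y = 0 := by
  ext v
  simp [differential_detPoly, h]

theorem pencil_single_zero (A : Fin 5 → Matrix (Fin 5) (Fin 5) ℂ) :
    pencil A (Pi.single 0 1) = A 0 := by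
  simp [pencil, Pi.single_apply]

theorem detPoly_ne_zero (hA : (A 0).det ≠ 0) : detPoly A ≠ 0 := fun h => hA <| by
  rw [← pencil_single_zero A, ← eval_detPoly, h, map_zero]

end Determinant

/-! ### Zeros of divisors of homogeneous polynomials -/

section Zeros

theorem eval_smul_of_isHomogeneous {ι : Type} {f : MvPolynomial ι ℂ} {d : ℕ}
    (hf : f.IsHomogeneous d) (c : ℂ) (v : ι → ℂ) : eval (c • v) f = c ^ d * eval v f := by
  rw [eval_eq, eval_eq, Finset.mul_sum]
  refine Finset.sum_congr rfl fun e he => ?_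
  have h : ∑ i ∈ e.support, e i = d := by
    rw [← hf (mem_support_iff.1 he), Finsupp.weight_apply, Finsupp.sum]
    simp
  simp only [Pi.smul_apply, smul_eq_mul, mul_pow, Finset.prod_mul_distrib, Finset.prod_pow_eq_pow_sum, h]
  ring

theorem exists_eval_add_smul {ι : Type} (f : MvPolynomial ι ℂ) (a b : ι → ℂ) :
    ∃ q : Polynomial ℂ, ∀ t, q.eval t = eval (a + t • b) f := by
  refine ⟨aeval (fun i => Polynomial.C (a i) + Polynomial.C (b i) * Polynomial.X) f, fun t => ?_⟩
  induction f using MvPolynomial.induction_on with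
  | C c => simp
  | add p q hp hq => simp [hp, hq]
  | mul_X p j hp => simp [hp, mul_comm t]

variable {ι : Type} [Fintype ι]

theorem differential_mul (f g : MvPolynomial ι ℂ) (x : ι → ℂ) :
    differential (f * g) x = eval x f • differential g x + eval x g • differential f x := by
  classical
  ext v
  simp [differential, Derivation.leibniz, add_smul, Finset.sum_add_distrib, Finset.smul_sum,
    mul_smul]

/-- If a homogeneous polynomial `f` does not vanish at `b`, every nonconstant divisor of it has
zeros outside of any finite set of lines. -/
theorem exists_eval_eq_zero_notMem_span {f g : MvPolynomial ι ℂ} {d : ℕ} (hf : f.IsHomogeneous d)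
    {b : ι → ℂ} (hb : eval b f ≠ 0) (hg : ¬ IsUnit g) (hgf : g ∣ f)
    (hι : 2 < Fintype.card ι) {P : Set (ι → ℂ)} (hP : P.Finite) :
    ∃ y, y ≠ 0 ∧ eval y g = 0 ∧ ∀ p ∈ P, y ∉ Submodule.span ℂ {p} := by
  classical
  obtain ⟨a₀, ha₀⟩ : ∃ a, eval a g = 0 := by
    by_contra! h
    have h1 : zeroLocus ℂ (Ideal.span {g}) = ∅ := by
      ext x
      refine iff_of_false (fun hx => h x ?_) (Set.notMem_empty x)
      simpa using hx g (Ideal.mem_span_singleton_self g)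
    have h2 := vanishingIdeal_zeroLocus_eq_radical (K := ℂ) (Ideal.span {g})
    rw [h1, vanishingIdeal_empty, eq_comm, Ideal.radical_eq_top, Ideal.span_singleton_eq_top] at h2
    exact hg h2
  -- By homogeneity `f` does not vanish at a₀ + tb for large t = s⁻¹, so neither does its divisor
  -- `g`, which is therefore nonconstant on this line.
  obtain ⟨t₁, ht₁⟩ : ∃ t : ℂ, eval (a₀ + t • b) g ≠ 0 := by
    obtain ⟨h, rfl⟩ := hgf
    have hc : Continuous fun s : ℂ => eval (s • a₀ + b) (g * h) :=
      (MvPolynomial.continuous_eval _).comp (by fun_prop)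
    have h0 : ∀ᶠ s in 𝓝 (0 : ℂ), eval (s • a₀ + b) (g * h) ≠ 0 :=
      hc.continuousAt.eventually_ne (by simpa using hb)
    obtain ⟨s, hs, hs0⟩ := ((infinite_of_mem_nhds _ h0).exists_notMem_finite
      (Set.finite_singleton (0 : ℂ)))
    refine ⟨s⁻¹, fun hz => hs ?_⟩
    have : s • a₀ + b = s • (a₀ + s⁻¹ • b) := by
      rw [smul_add, smul_smul, mul_inv_cancel₀ hs0, one_smul]
    rw [this, eval_smul_of_isHomogeneous hf, map_mul, hz, zero_mul, mul_zero]
  let W : (ι → ℂ) → Submodule ℂ (ι → ℂ) := fun p => Submodule.span ℂ {b, p}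
  have hPf : (insert 0 P).Finite := hP.insert 0
  -- Moving a₀ in a direction outside the finitely many subspaces `W p` makes the line in direction
  -- b avoid every forbidden line. Including p = 0 makes the zero found on it nonzero.
  obtain ⟨c, hc⟩ : ∃ c, ∀ p ∈ insert 0 P, c ∉ W p := by
    have hW : ⊤ ∉ hPf.toFinset.image W := by
      intro h
      obtain ⟨p, -, hp⟩ := Finset.mem_image.1 h
      have h1 := finrank_span_finset_le_card (R := ℂ) ({b, p} : Finset (ι → ℂ))
      have h2 : Submodule.span ℂ (({b, p} : Finset (ι → ℂ)) : Set (ι → ℂ)) = ⊤ := by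
        rw [← hp]; simp [W]
      rw [Set.finrank, h2, finrank_top, Module.finrank_fintype_fun_eq_card] at h1
      have := Finset.card_le_two (a := b) (b := p)
      omega
    obtain ⟨c, hc⟩ := (Set.ne_univ_iff_exists_notMem _).1
      (Subspace.biUnion_ne_univ_of_top_notMem hW)
    refine ⟨c, fun p hp hcp => hc ?_⟩
    exact Set.mem_biUnion (Finset.mem_coe.2 (Finset.mem_image_of_mem W (hPf.mem_toFinset.2 hp))) hcp
  have hopen : ∀ᶠ s in 𝓝 (0 : ℂ), eval (a₀ + s • c + t₁ • b) g - eval (a₀ + s • c) g ≠ 0 := by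
    have hc : Continuous fun s : ℂ => eval (a₀ + s • c + t₁ • b) g - eval (a₀ + s • c) g :=
      ((MvPolynomial.continuous_eval _).comp (by fun_prop)).sub
        ((MvPolynomial.continuous_eval _).comp (by fun_prop))
    exact hc.continuousAt.eventually_ne (by simpa [ha₀] using ht₁)
  have hbad : (⋃ p ∈ insert 0 P, {s : ℂ | a₀ + s • c ∈ W p}).Finite := by
    refine hPf.biUnion fun p hp => Set.Subsingleton.finite fun s hs s' hs' => ?_
    by_contra hne
    have h1 : (s - s') • c ∈ W p := by
      have := (W p).sub_mem hs hs'
      rwa [add_sub_add_left_eq_sub, ← sub_smul] at this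
    exact hc p hp (((W p).smul_mem_iff (sub_ne_zero.2 hne)).1 h1)
  obtain ⟨s, hs, hsW⟩ := (infinite_of_mem_nhds _ hopen).exists_notMem_finite hbad
  simp only [Set.mem_iUnion, not_exists] at hsW
  obtain ⟨q, hq⟩ := exists_eval_add_smul g (a₀ + s • c) b
  obtain ⟨t, ht⟩ := IsAlgClosed.exists_root q fun hdeg => hs <| by
    rw [Polynomial.eq_C_of_degree_eq_zero hdeg] at hq
    have h0 := hq 0
    have h1 := hq t₁
    rw [Polynomial.eval_C] at h0 h1
    rw [zero_smul, add_zero] at h0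
    rw [← h0, ← h1, sub_self]
  have hy : ∀ p ∈ insert 0 P, a₀ + s • c + t • b ∉ Submodule.span ℂ {p} := by
    intro p hp hmem
    refine hsW p hp ?_
    have h1 : a₀ + s • c + t • b ∈ W p :=
      Submodule.span_mono (by simp) hmem
    have h2 : t • b ∈ W p := Submodule.smul_mem _ _ (Submodule.subset_span (by simp))
    simpa using (W p).sub_mem h1 h2
  refine ⟨_, fun h0 => hy 0 (Set.mem_insert _ _) ?_, ?_, fun p hp => hy p (Set.mem_insert_of_mem _ hp)⟩
  · rw [h0]; exact zero_mem _
  · rw [← hq]; exact ht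

end Zeros

/-! ### Ideal, tangent spaces and singular locus of the quintic -/

section Quintic

open Matrix

/-- The determinantal quintic of a linear system of matrices. -/
def quintic (A : Fin 5 → Matrix (Fin 5) (Fin 5) ℂ) : Set (ℙ ℂ (Fin 5 → ℂ)) :=
  {y | Matrix.det (∑ k, y.rep k • A k) = 0}

variable {A : Fin 5 → Matrix (Fin 5) (Fin 5) ℂ}

theorem mem_cone_quintic {v : Fin 5 → ℂ} :
    v ∈ cone (quintic A) ↔ v ≠ 0 ∧ (pencil A v).det = 0 := mem_cone_iff

theorem mem_quintic {p : ℙ ℂ (Fin 5 → ℂ)} : p ∈ quintic A ↔ (pencil A p.rep).det = 0 := Iff.rfl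

theorem mem_span_degeneracyLocus (hT : IsTransversal A) {y : Fin 5 → ℂ} (hy : y ≠ 0)
    (h : (pencil A y).adjugate = 0) :
    ∃ v ∈ degeneracyLocus A, y = y 0 • (Fin.cons 1 v : Fin 5 → ℂ) := by
  have hy0 := (hT y hy h).1
  have hv : y = y 0 • (Fin.cons 1 fun k => (y 0)⁻¹ * y k.succ : Fin 5 → ℂ) := by
    ext k
    refine Fin.cases ?_ (fun k => ?_) k
    · simp
    · simp [hy0]
  refine ⟨_, ?_, hv⟩
  rw [hv, pencil_smul, adjugate_smul, smul_eq_zero] at h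
  exact h.resolve_left (pow_ne_zero _ hy0)

/-- A nonconstant divisor of the equation of the quintic has a zero of corank one. -/
theorem exists_eval_eq_zero_adjugate_ne_zero (hT : IsTransversal A) (hA : (A 0).det ≠ 0)
    {g : MvPolynomial (Fin 5) ℂ} (hg : ¬ IsUnit g) (hgf : g ∣ detPoly A) :
    ∃ y, y ≠ 0 ∧ eval y g = 0 ∧ (pencil A y).adjugate ≠ 0 := by
  have hfin := (finite_and_eventually_ncard_degeneracyLocus_eq hT 0).1
  obtain ⟨y, hy, hyg, hP⟩ := exists_eval_eq_zero_notMem_span (isHomogeneous_detPoly A)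
    (b := Pi.single 0 1) (by rwa [eval_detPoly, pencil_single_zero]) hg hgf (by simp)
    (hfin.image fun v => (Fin.cons 1 v : Fin 5 → ℂ))
  refine ⟨y, hy, hyg, fun h => ?_⟩
  obtain ⟨v, hv, hyv⟩ := mem_span_degeneracyLocus hT hy h
  exact hP _ (Set.mem_image_of_mem _ hv) (Submodule.mem_span_singleton.2 ⟨_, hyv.symm⟩)

theorem not_isUnit_detPoly : ¬ IsUnit (detPoly A) := fun h => by
  have h0 : eval (0 : Fin 5 → ℂ) (detPoly A) = 0 := by
    have := eval_smul_of_isHomogeneous (isHomogeneous_detPoly A) 0 0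
    simpa using this
  have := h.map (eval (0 : Fin 5 → ℂ))
  rw [h0] at this
  exact not_isUnit_zero this

/-- At a zero of a repeated factor both the determinant and its differential vanish, so the corank
is at least two; but a nonconstant factor also has zeros of corank one. -/
theorem squarefree_detPoly (hT : IsTransversal A) (hA : (A 0).det ≠ 0)
    (hN : ∀ y N, y ≠ 0 → Annihilates A y N → N = 0) : Squarefree (detPoly A) := by
  intro g hg
  by_contra hu
  obtain ⟨y, hy, hyg, hadj⟩ := exists_eval_eq_zero_adjugate_ne_zero hT hA hu
    (dvd_of_mul_left_dvd hg)
  obtain ⟨h, hh⟩ := hg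
  refine hadj (adjugate_eq_zero_of_differential_eq_zero (fun N => hN y N hy) ?_ ?_)
  · rw [← eval_detPoly, hh]; simp [hyg]
  · rw [hh, differential_mul, differential_mul]; simp [hyg]

theorem projIdeal_quintic (hT : IsTransversal A) (hA : (A 0).det ≠ 0)
    (hN : ∀ y N, y ≠ 0 → Annihilates A y N → N = 0) :
    projIdeal (quintic A) = Ideal.span {detPoly A} := by
  have hrad : (Ideal.span {detPoly A}).IsRadical :=
    isRadical_iff_span_singleton.1
      ((isRadical_iff_squarefree_of_ne_zero (detPoly_ne_zero hA)).2 (squarefree_detPoly hT hA hN))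
  have h1 := vanishingIdeal_zeroLocus_eq_radical (K := ℂ) (Ideal.span {detPoly A})
  rw [hrad.radical] at h1
  rw [← h1]
  have hz : ∀ v, v ∈ zeroLocus ℂ (Ideal.span {detPoly A}) ↔ (pencil A v).det = 0 := by
    intro v
    rw [← eval_detPoly]
    refine ⟨fun h => by simpa using h _ (Ideal.mem_span_singleton_self _), fun h f hf => ?_⟩
    obtain ⟨g, rfl⟩ := Ideal.mem_span_singleton.1 hf
    simp [h]
  refine le_antisymm (fun f hf v hv => ?_) (fun f hf v hv => ?_)
  · by_cases hv0 : v = 0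
    -- The cone omits the origin, where the Nullstellensatz also needs vanishing; a line through the
    -- origin and a point of the quintic supplies it.
    · obtain ⟨y, hy, hyf, -⟩ := exists_eval_eq_zero_adjugate_ne_zero hT hA not_isUnit_detPoly
        dvd_rfl
      obtain ⟨q, hq⟩ := exists_eval_add_smul f 0 y
      have hq0 : q = 0 := by
        refine Polynomial.eq_zero_of_infinite_isRoot q
          ((Set.finite_singleton (0 : ℂ)).infinite_compl.mono fun t ht => ?_)
        have : t • y ∈ cone (quintic A) := by
          refine mem_cone_quintic.2 ⟨smul_ne_zero ht hy, ?_⟩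
          rw [← eval_detPoly, eval_smul_of_isHomogeneous (isHomogeneous_detPoly A), hyf, mul_zero]
        have h2 := hf _ this
        rw [aeval_eq_eval] at h2
        change q.eval t = 0
        rw [hq, zero_add]
        simpa using h2
      have := hq 0
      rw [hq0, zero_smul, add_zero] at this
      simpa [hv0] using this.symm
    · exact hf v (mem_cone_quintic.2 ⟨hv0, (hz v).1 hv⟩)
  · exact hf v ((hz v).2 (mem_cone_quintic.1 hv).2)

theorem tangentSpace_quintic (hT : IsTransversal A) (hA : (A 0).det ≠ 0)
    (hN : ∀ y N, y ≠ 0 → Annihilates A y N → N = 0) {p : ℙ ℂ (Fin 5 → ℂ)} (hp : p ∈ quintic A) :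
    tangentSpace (quintic A) p = LinearMap.ker (differential (detPoly A) p.rep) := by
  rw [tangentSpace, projIdeal_quintic hT hA hN]
  refine le_antisymm (iInf₂_le _ (Ideal.mem_span_singleton_self _)) (le_iInf₂ fun f hf v hv => ?_)
  obtain ⟨g, rfl⟩ := Ideal.mem_span_singleton.1 hf
  rw [LinearMap.mem_ker] at hv ⊢
  rw [differential_mul, eval_detPoly, mem_quintic.1 hp]
  simp [hv]

theorem finrank_tangentSpace_quintic (hT : IsTransversal A) (hA : (A 0).det ≠ 0)
    (hN : ∀ y N, y ≠ 0 → Annihilates A y N → N = 0) {p : ℙ ℂ (Fin 5 → ℂ)} (hp : p ∈ quintic A) :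
    Module.finrank ℂ (tangentSpace (quintic A) p) =
      if (pencil A p.rep).adjugate = 0 then 5 else 4 := by
  rw [tangentSpace_quintic hT hA hN hp]
  split_ifs with h
  · rw [differential_eq_zero_of_adjugate_eq_zero h, LinearMap.ker_zero, finrank_top]
    simp
  · have hd : differential (detPoly A) p.rep ≠ 0 := fun hd =>
      h (adjugate_eq_zero_of_differential_eq_zero (fun N => hN _ N p.rep_nonzero) hp hd)
    have := Module.Dual.finrank_ker_add_one_of_ne_zero hd
    simpa using this

theorem singularLocus_quintic (hT : IsTransversal A) (hA : (A 0).det ≠ 0)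
    (hN : ∀ y N, y ≠ 0 → Annihilates A y N → N = 0) :
    singularLocus (quintic A) = {p | (pencil A p.rep).adjugate = 0} := by
  -- Smoothness is minimality of the tangent dimension, so a point of corank one is needed to show
  -- that 4 is attained.
  obtain ⟨y, hy, hyf, hadj⟩ := exists_eval_eq_zero_adjugate_ne_zero hT hA not_isUnit_detPoly
    dvd_rfl
  obtain ⟨c, hc⟩ := Projectivization.exists_smul_eq_mk_rep ℂ y hy
  have hc' : (Projectivization.mk ℂ y hy).rep = (c : ℂ) • y := hc.symm
  have hq : Projectivization.mk ℂ y hy ∈ quintic A := by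
    rw [mem_quintic, hc', pencil_smul, det_smul, ← eval_detPoly, hyf, mul_zero]
  have hqadj : (pencil A (Projectivization.mk ℂ y hy).rep).adjugate ≠ 0 := by
    rw [hc', pencil_smul, adjugate_smul]
    exact smul_ne_zero (pow_ne_zero _ c.ne_zero) hadj
  ext p
  constructor
  · rintro ⟨hp, hs⟩
    by_contra h
    refine hs ⟨hp, fun q hq => ?_⟩
    rw [finrank_tangentSpace_quintic hT hA hN hp, finrank_tangentSpace_quintic hT hA hN hq,
      if_neg (show ¬ (pencil A p.rep).adjugate = 0 from h)]
    split_ifs <;> norm_num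
  · intro h
    have hp : p ∈ quintic A := det_eq_zero_of_adjugate_eq_zero h
    refine ⟨hp, fun hs => ?_⟩
    have := hs.2 _ hq
    rw [finrank_tangentSpace_quintic hT hA hN hp, finrank_tangentSpace_quintic hT hA hN hq,
      if_pos (show (pencil A p.rep).adjugate = 0 from h), if_neg hqadj] at this
    norm_num at this

theorem ncard_singularLocus_quintic (hT : IsTransversal A) (hA : (A 0).det ≠ 0)
    (hN : ∀ y N, y ≠ 0 → Annihilates A y N → N = 0) :
    (singularLocus (quintic A)).ncard = (degeneracyLocus A).ncard := by
  rw [singularLocus_quintic hT hA hN]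
  symm
  refine Set.ncard_congr (fun v _ => Projectivization.mk ℂ (Fin.cons 1 v) (cons_one_ne_zero v))
    (fun v hv => ?_) (fun v w _ _ h => ?_) (fun p hp => ?_)
  · obtain ⟨c, hc⟩ := Projectivization.exists_smul_eq_mk_rep ℂ _ (cons_one_ne_zero v)
    have hv' : (pencil A (Fin.cons 1 v)).adjugate = 0 := hv
    rw [Set.mem_ofPred_eq, ← hc, Units.smul_def, pencil_smul, adjugate_smul, hv', smul_zero]
  · rw [Projectivization.mk_eq_mk_iff'] at h
    obtain ⟨a, ha⟩ := h
    have h0 := congrFun ha 0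
    simp only [Pi.smul_apply, Fin.cons_zero, smul_eq_mul, mul_one] at h0
    rw [h0, one_smul] at ha
    exact ((Fin.cons_injective2 ha).2).symm
  · obtain ⟨v, hv, hpv⟩ := mem_span_degeneracyLocus hT p.rep_nonzero hp
    refine ⟨v, hv, ?_⟩
    rw [← p.mk_rep, Projectivization.mk_eq_mk_iff']
    refine ⟨(p.rep 0)⁻¹, ?_⟩
    have hp0 := (hT _ p.rep_nonzero hp).1
    exact (inv_smul_eq_iff₀ hp0).2 hpv

/-- At a zero matrix the kernel and cokernel are everything, and 25 ≥ 5 produces an annihilator. -/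
theorem injective_spanMap (hN : ∀ y N, y ≠ 0 → Annihilates A y N → N = 0) :
    Function.Injective (spanMap A) := by
  rw [← LinearMap.ker_eq_bot, LinearMap.ker_eq_bot']
  intro y hy
  by_contra hy0
  have h0 : pencil A y = 0 := by rw [← toMatrix_spanMap, hy]; rfl
  obtain ⟨N, hN0, hNA⟩ := exists_annihilates_of_card_le (A := A) hy0
    (R := (1 : Matrix (Fin 5) (Fin 5) ℂ)) (R' := 1) (E := (1 : Matrix (Fin 5) (Fin 5) ℂ)) (E' := 1)
    (by rw [h0, zero_mul]) (by rw [h0, mul_zero]) (mul_one 1) (mul_one 1) (by simp)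
  exact hN0 (hN y N hy0 hNA)

end Quintic

/-! ### General systems and the deformation to the example -/

section General

open Matrix

/-- A general linear system has no nonzero annihilators, is transversal, and contains an
invertible matrix. -/
theorem exists_forall_isTransversal :
    ∃ F : MvPolynomial (Fin 5 × Fin 5 × Fin 5) ℂ, F ≠ 0 ∧
      ∀ A : Fin 5 → Matrix (Fin 5) (Fin 5) ℂ, eval (fun t => A t.1 t.2.1 t.2.2) F ≠ 0 →
        IsTransversal A ∧ (A 0).det ≠ 0 ∧ ∀ y N, y ≠ 0 → Annihilates A y N → N = 0 := by
  obtain ⟨F, hF, h⟩ := exists_forall_not_annihilates (Fin 5) (Fin 5)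
  -- Genericity of the last four matrices keeps corank two out of the hyperplane y 0 = 0, since
  -- there 2 · 2 ≥ 4 would force an annihilator.
  obtain ⟨G, hG, h'⟩ := exists_forall_not_annihilates (Fin 4) (Fin 5)
  let ρ : Fin 4 × Fin 5 × Fin 5 → Fin 5 × Fin 5 × Fin 5 := fun t => (t.1.succ, t.2)
  have hρ : Function.Injective ρ := fun s t hst => by
    obtain ⟨h1, h2⟩ := Prod.mk.inj hst
    exact Prod.ext (Fin.succ_injective _ h1) h2
  let D : MvPolynomial (Fin 5 × Fin 5 × Fin 5) ℂ := det (of fun i j => X (0, i, j))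
  have hD : ∀ A : Fin 5 → Matrix (Fin 5) (Fin 5) ℂ,
      eval (fun t => A t.1 t.2.1 t.2.2) D = (A 0).det := by
    intro A
    rw [RingHom.map_det]
    congr 1
    ext i j
    simp
  refine ⟨F * rename ρ G * D, mul_ne_zero (mul_ne_zero hF ?_) ?_, fun A hA => ?_⟩
  · rwa [Ne, map_eq_zero_iff _ (rename_injective ρ hρ)]
  · intro hD0
    have := hD fun _ => 1
    rw [hD0] at this
    simp at this
  · rw [map_mul, map_mul, hD, eval_rename] at hA
    have hN := h A (left_ne_zero_of_mul (left_ne_zero_of_mul hA))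
    refine ⟨fun y hy hadj => ⟨fun hy0 => ?_, fun N => hN y N hy⟩, right_ne_zero_of_mul hA, hN⟩
    have hp : pencil (fun k => A k.succ) (fun k : Fin 4 => y k.succ) = pencil A y := by
      simp [pencil, Fin.sum_univ_succ, hy0]
    have hy' : (fun k : Fin 4 => y k.succ) ≠ 0 := fun h0 => hy <| by
      ext k
      exact Fin.cases hy0 (fun k => congrFun h0 k) k
    obtain ⟨N, hN0, hN⟩ := exists_annihilates_of_adjugate_eq_zero (A := fun k => A k.succ) hy'
      (by rw [hp, hadj])
    exact hN0 (h' (fun k => A k.succ) (right_ne_zero_of_mul (left_ne_zero_of_mul hA)) _ N hy' hN)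

theorem ncard_degeneracyLocus_eq_fifty {F : MvPolynomial (Fin 5 × Fin 5 × Fin 5) ℂ}
    (hF : ∀ A : Fin 5 → Matrix (Fin 5) (Fin 5) ℂ,
      eval (fun t => A t.1 t.2.1 t.2.2) F ≠ 0 → IsTransversal A)
    {A : Fin 5 → Matrix (Fin 5) (Fin 5) ℂ} (hA : eval (fun t => A t.1 t.2.1 t.2.2) F ≠ 0) :
    (degeneracyLocus A).ncard = 50 := by
  obtain ⟨q, hq⟩ := exists_eval_add_smul F (fun t => baseSystem t.1 t.2.1 t.2.2)
    fun t => (A - baseSystem) t.1 t.2.1 t.2.2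
  have hq' : ∀ t : ℂ, q.eval t =
      eval (fun s => (baseSystem + t • (A - baseSystem)) s.1 s.2.1 s.2.2) F := hq
  have h1 : q.eval 1 ≠ 0 := by simpa [hq'] using hA
  have hq0 : q ≠ 0 := by rintro rfl; simp at h1
  -- The special system may itself be a zero of `F`, so t = 0 is taken out of the bad set and its
  -- transversality is supplied by `isTransversal_baseSystem`.
  have key := ncard_degeneracyLocus_eq (A := baseSystem) (B := A - baseSystem)
    (s := {t | q.IsRoot t} \ {0}) ((Polynomial.finite_setOfPred_isRoot hq0).sdiff) (by simp)
    (by simpa using h1) fun t ht => ?_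
  · rwa [add_sub_cancel, ncard_degeneracyLocus_baseSystem] at key
  · by_cases ht0 : t = 0
    · rw [ht0, zero_smul, add_zero]
      exact isTransversal_baseSystem
    · exact hF _ fun h => ht ⟨(hq' t).trans h, ht0⟩

end General

end DualQuintic

end

open DualQuintic in
theorem mainTheorem7 :
    ∃ F : MvPolynomial (Fin 5 × Fin 5 × Fin 5) ℂ, F ≠ 0 ∧
      ∀ A : Fin 5 → Matrix (Fin 5) (Fin 5) ℂ,
        MvPolynomial.eval (fun t => A t.1 t.2.1 t.2.2) F ≠ 0 →
        ∃ hA : Function.Injective (spanMap A),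
          ∃ X : Set (ℙ ℂ (Fin 5 → ℂ)),
            mukaiDual (Set.range segre) (dualPoint A) =
              Projectivization.map (spanMap A) hA '' X ∧
            X = {y | Matrix.det (∑ k, y.rep k • A k) = 0} ∧
            projIdeal X = Ideal.span {detPoly A} ∧
            detPoly A ≠ 0 ∧ (detPoly A).IsHomogeneous 5 ∧
            (singularLocus X).ncard = 50 ∧
            ∀ p ∈ singularLocus X, IsOrdinaryDoublePoint X p := by
  obtain ⟨F, hF, h⟩ := exists_forall_isTransversal
  refine ⟨F, hF, fun A hFA => ?_⟩
  obtain ⟨hT, hdet, hN⟩ := h A hFA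
  have hinj := injective_spanMap hN
  refine ⟨hinj, quintic A, mukaiDual_segre A hinj, rfl, projIdeal_quintic hT hdet hN,
    detPoly_ne_zero hdet, isHomogeneous_detPoly A, ?_, fun p hp => ?_⟩
  · rw [ncard_singularLocus_quintic hT hdet hN]
    exact ncard_degeneracyLocus_eq_fifty (fun B hB => (h B hB).1) hFA
  · rw [singularLocus_quintic hT hdet hN] at hp
    obtain ⟨hp0, hpN⟩ := hT p.rep p.rep_nonzero hp
    exact isOrdinaryDoublePoint_of_transversal hp0 hp hpN
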